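/- Let $n\ge 1$ and $m\ge 0$ be integers. The book with $n-1$ pages consists of $n-1$ copies of the closed upper half-plane, glued along the real line $\mathbb{R}$. An $n$-wave graph with $m$ vertices is a simple graph with the vertices $1,2,\dots,m$, each connected component of which is a path with $n-1$ edges $\{i_1,i_2\},\{i_2,i_3\},\dots,\{i_{n-1},i_n\}$ such that $i_1<i_2<\dots<i_n$, and which can be drawn in the book with $n-1$ pages, with vertex $i$ at the point $i\in\mathbb{R}$, such that for every connected component and every $N=1,\dots,n-1$ the edge $\{i_N,i_{N+1}\}$ is drawn on the $N$-th page, without intersections. (Each edge is drawn as a simple arc joining its endpoints, whose other points lie in the open half-plane of its page; distinct arcs may meet only in common endpoints.) The number of $n$-wave graphs with $m$ vertices is nonzero if and only if $m=kn$ for some integer $k$. In that case it equals $$\frac{m!\,\bigl(1!\,2!\cdots (n-1)!\bigr)}{k!\,(k+1)!\cdots (k+n-1)!}.$$ More precisely, let $m=kn$, and consider the words $\alpha_1\dots\alpha_m$ in the alphabet $\{1,\dots,n\}$ that contain exactly $k$ copies of each letter and are lattice words, which means that every initial segment contains at least as many $1$'s as $2$'s, at least as many $2$'s as $3$'s, and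 so on. Then: (a) there is a bijection from the set of $n$-wave graphs with $m$ vertices onto the set of these words, which sends a graph to the word with $\alpha_{i_N}=N$ for every connected component $i_1<i_2<\dots<i_n$ and every $N=1,\dots,n$; (b) there is a bijection from the set of standard Young tableaux of the rectangular shape $n^k$ ($k$ rows of length $n$) onto the set of these words, which sends a tableau to the word in which $\alpha_i$ is the number of the column that contains the entry $i$. -/

import Mathlib

open scoped Nat

/-- The point of the real line, seen as the boundary of the upper half-plane in `ℂ`, at which the
vertex `i` is placed. The vertices `1, …, m` are the elements `0, …, m - 1` of `Fin m`. -/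
noncomputable def vertexPoint {m : ℕ} (i : Fin m) : ℂ := ((i : ℕ) : ℂ) + 1

/-- A drawing of a graph with vertices `1, …, m` in the book with `K` pages, that is, in `K` copies
of the closed upper half-plane glued along the real line. The vertices are placed at the points
`1, …, m` of the real line. Each edge is drawn on one page, as a simple arc which joins its two
endpoints and whose other points lie in the open half-plane. The arcs do not intersect, except in
common endpoints. (Two different pages have only the real line in common, so that arcs on different
pages can only meet in common endpoints, and only arcs on the same page have to be compared.) -/
structure BookDrawing {m : ℕ} (G : SimpleGraph (Fin m)) (K : ℕ) where
  /-- the page on which an edge is drawn -/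
  page : G.edgeSet → Fin K
  /-- the arc in the page by which an edge is drawn -/
  arc : G.edgeSet → C(unitInterval, ℂ)
  arc_injective : ∀ e, Function.Injective (arc e)
  arc_ends : ∀ e, s(arc e 0, arc e 1) = Sym2.map vertexPoint (e : Sym2 (Fin m))
  arc_interior : ∀ e, ∀ t ∈ Set.Ioo (0 : unitInterval) 1, 0 < (arc e t).im
  no_intersection : ∀ e f, e ≠ f → page e = page f →
    ∀ s ∈ Set.Ioo (0 : unitInterval) 1, ∀ t ∈ Set.Ioo (0 : unitInterval) 1, arc e s ≠ arc f t

/-- `p` lists the vertices `i₁, i₂, …, iₙ` of the connected component `c` along a path with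
`n - 1` edges, which is the whole component, and `i₁ < i₂ < … < iₙ`. -/
def IsWave {m n : ℕ} {G : SimpleGraph (Fin m)} (c : G.ConnectedComponent)
    (p : SimpleGraph.pathGraph n ≃g c.toSimpleGraph) : Prop :=
  StrictMono fun a : Fin n => (p a : Fin m)

/-- `n`-wave graphs on the vertices `1, …, m`: each connected component is a path
`i₁ < i₂ < … < iₙ`, and the graph can be drawn in the book with `n - 1` pages such that the
edge `{i_N, i_{N+1}}` of each component is drawn on the `N`-th page. (Positions in a path and pages
are numbered from `0` in the code.) -/
def IsWaveGraph (n : ℕ) {m : ℕ} (G : SimpleGraph (Fin m)) : Prop :=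
  ∃ wave : ∀ c : G.ConnectedComponent, SimpleGraph.pathGraph n ≃g c.toSimpleGraph,
    (∀ c, IsWave c (wave c)) ∧
    ∃ D : BookDrawing G (n - 1), ∀ (c : G.ConnectedComponent) (a b : Fin n) (e : G.edgeSet),
      (a : ℕ) + 1 = b → (e : Sym2 (Fin m)) = s((wave c a : Fin m), (wave c b : Fin m)) →
        (D.page e : ℕ) = a

/-- The set of `n`-wave graphs with `m` vertices. -/
def WaveGraph (n m : ℕ) : Type := {G : SimpleGraph (Fin m) // IsWaveGraph n G}

/-- Lattice words of length `m` in the alphabet `{1, …, n}` (the letters are numbered from `0` in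
the code): each initial part contains at least as many 1's as 2's, at least as many 2's as 3's,
and so on. -/
def IsLatticeWord {n m : ℕ} (w : Fin m → Fin n) : Prop :=
  ∀ (i : Fin m) (a b : Fin n), (a : ℕ) + 1 = b →
    (Finset.univ.filter fun j => j ≤ i ∧ w j = b).card ≤
      (Finset.univ.filter fun j => j ≤ i ∧ w j = a).card

/-- Lattice words of length `m` that contain exactly `k` copies of each letter `1, …, n`. -/
def BalancedLatticeWord (n k m : ℕ) : Type :=
  {w : Fin m → Fin n // IsLatticeWord w ∧
    ∀ a : Fin n, (Finset.univ.filter fun j => w j = a).card = k}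

/-- The Young diagram of the partition `n^k`, with `k` rows of length `n`. -/
def rectDiagram (n k : ℕ) : YoungDiagram where
  cells := Finset.range k ×ˢ Finset.range n
  isLowerSet := by
    rintro ⟨i, j⟩ ⟨i', j'⟩ h hij
    obtain ⟨h1, h2⟩ := Prod.mk_le_mk.mp h
    simp only [Finset.coe_product, Finset.coe_range, Set.mem_prod, Set.mem_Iio] at hij ⊢
    omega

/-- Standard Young tableaux of shape `μ`: each of the numbers `1, …, |μ|` is written in exactly one
cell, and the entries increase along rows and columns. (They increase strictly along rows since
they are distinct.) -/
def StandardTableau (μ : YoungDiagram) : Type :=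
  {T : SemistandardYoungTableau μ //
    Set.BijOn (fun c : ℕ × ℕ => T c.1 c.2) μ.cells (Set.Icc 1 μ.card)}

/-!
Two arcs on one page whose endpoints interlace must meet: otherwise a continuous argument of the
difference of their points would exist on the unit square, but its increments along the boundary add
up to a full turn. Conversely, parabolas with endpoints that do not interlace are disjoint. Hence an
`n`-wave graph is the same as a word (the positions of the vertices in their paths) with a matching
that, for each `a < n`, pairs the letters `a` with the letters `a + 1` to their right like opening
and closing parentheses. Such noncrossing matchings are determined by the word, and they exist if
and only if it is a lattice word in which all letters occur equally often.

The words that correspond to tableaux are lattice words because entries increase along rows, and a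
lattice word gives back the tableau whose columns list the positions of the letters. Finally, the
number of lattice words with letter multiplicities `μ` is `m! det(1 / (μ_i - i + j)!)`: both sides
are sums over the multiplicities left when the last letter is removed. For a rectangle this is a
Vandermonde determinant.
-/

section Winding

lemma continuous_arg_of_im_nonneg {X : Type*} [TopologicalSpace X] {f : X → ℂ} (hf : Continuous f)
    (h0 : ∀ x, f x ≠ 0) (him : ∀ x, 0 ≤ (f x).im) : Continuous fun x => Complex.arg (f x) := by
  refine continuous_iff_continuousAt.mpr fun x => ?_
  by_cases hx : f x ∈ Complex.slitPlane
  · exact (Complex.continuousAt_arg hx).comp hf.continuousAt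
  · rw [Complex.mem_slitPlane_iff, not_or, not_lt, not_not] at hx
    have hre : (f x).re < 0 := hx.1.lt_of_ne fun hr => h0 x (Complex.ext hr hx.2)
    exact (Complex.continuousWithinAt_arg_of_re_neg_of_im_zero hre hx.2).tendsto.comp
      (tendsto_nhdsWithin_iff.mpr ⟨hf.continuousAt, Filter.Eventually.of_forall him⟩)

variable {X : Type*} [TopologicalSpace X] [PreconnectedSpace X] {F f : X → ℂ}

lemma im_sub_im_eq_arg_sub_arg (hF : Continuous F) (h : ∀ x, Complex.exp (F x) = f x)
    (him : ∀ x, 0 ≤ (f x).im) (x y : X) :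
    (F y).im - (F x).im = Complex.arg (f y) - Complex.arg (f x) := by
  have h0 : ∀ x, f x ≠ 0 := fun x => h x ▸ Complex.exp_ne_zero _
  have hf : Continuous f := funext h ▸ Complex.continuous_exp.comp hF
  have hexp : ∀ x, ∃ k : ℤ, F x = Complex.log (f x) + k * (2 * Real.pi * Complex.I) := fun x =>
    Complex.exp_eq_exp_iff_exists_int.mp (by rw [h, Complex.exp_log (h0 x)])
  choose k hk using hexp
  have hk' : ∀ x, (k x : ℝ) = ((F x).im - Complex.arg (f x)) / (2 * Real.pi) := fun x => by
    rw [hk x, eq_div_iff (by positivity)]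
    simp [Complex.log_im]
  have hcont : Continuous k := by
    rw [Int.isClosedEmbedding_coe_real.isEmbedding.continuous_iff,
      show ((↑) : ℤ → ℝ) ∘ k = _ from funext hk']
    exact ((Complex.continuous_im.comp hF).sub
      (continuous_arg_of_im_nonneg hf h0 him)).div_const _
  have hxy := hk' y
  rw [PreconnectedSpace.constant inferInstance hcont (x := y) (y := x), hk' x,
    div_left_inj' (by positivity)] at hxy
  linarith

lemma im_sub_im_eq_arg_neg_sub_arg_neg (hF : Continuous F) (h : ∀ x, Complex.exp (F x) = f x)
    (him : ∀ x, (f x).im ≤ 0) (x y : X) :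
    (F y).im - (F x).im = Complex.arg (-f y) - Complex.arg (-f x) := by
  simpa using im_sub_im_eq_arg_sub_arg (F := fun x => F x + Real.pi * Complex.I)
    (f := fun x => -f x) (by fun_prop) (fun x => by rw [Complex.exp_add, h]; simp)
    (fun x => by simpa using him x) x y

lemma exists_continuous_exp_eq_sub (γ δ : C(unitInterval, ℂ)) (hne : ∀ s t, γ s ≠ δ t) :
    ∃ L : unitInterval × unitInterval → ℂ, Continuous L ∧
      ∀ s t, Complex.exp (L (s, t)) = γ s - δ t := by
  let proj : ℝ → unitInterval := Set.projIcc 0 1 zero_le_one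
  have hproj : Continuous proj := continuous_projIcc
  have hsc : IsSimplyConnected (Set.univ : Set (ℝ × ℝ)) := by
    have := convex_univ.contractibleSpace (Set.univ_nonempty (α := ℝ × ℝ))
    exact SimplyConnectedSpace.ofContractible _
  obtain ⟨L, hLc, hL⟩ := Complex.exists_continuousOn_eqOn_exp_comp hsc isOpen_univ
    (g := fun p => γ (proj p.1) - δ (proj p.2)) (Continuous.continuousOn (by fun_prop))
    (by rintro ⟨p, -, hp⟩; exact hne _ _ (sub_eq_zero.mp hp))
  rw [continuousOn_univ] at hLc
  refine ⟨fun p => L (p.1, p.2), by fun_prop, fun s t => ?_⟩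
  simpa only [Function.comp_apply, proj, Set.projIcc_val] using hL (Set.mem_univ ((s : ℝ), (t : ℝ)))

-- If the paths did not meet, a continuous argument of `γ s - δ t` would exist on the unit square,
-- but along the boundary of the square its increments add up to `-2π`.
lemma exists_eq_of_interlacing {γ δ : C(unitInterval, ℂ)} {a b c d : ℝ} (hab : a < b) (hbc : b < c)
    (hcd : c < d) (hγ0 : γ 0 = a) (hγ1 : γ 1 = c) (hδ0 : δ 0 = b) (hδ1 : δ 1 = d)
    (hγ : ∀ t, 0 ≤ (γ t).im) (hδ : ∀ t, 0 ≤ (δ t).im) : ∃ s t, γ s = δ t := by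
  by_contra! hne
  obtain ⟨L, hLc, hL⟩ := exists_continuous_exp_eq_sub γ δ hne
  have arg_pos : ∀ {x y : ℝ}, x < y → Complex.arg ((y : ℂ) - x) = 0 := fun h => by
    rw [← Complex.ofReal_sub, Complex.arg_ofReal_of_nonneg (by linarith)]
  have arg_neg : ∀ {x y : ℝ}, x < y → Complex.arg ((x : ℂ) - y) = Real.pi := fun h => by
    rw [← Complex.ofReal_sub, Complex.arg_ofReal_of_neg (by linarith)]
  have bottom := im_sub_im_eq_arg_sub_arg (F := fun s => L (s, 0)) (by fun_prop) (fun s => hL s 0)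
    (fun s => by simpa [hδ0] using hγ s) 0 1
  have right := im_sub_im_eq_arg_neg_sub_arg_neg (F := fun t => L (1, t)) (by fun_prop)
    (fun t => hL 1 t) (fun t => by simpa [hγ1] using hδ t) 0 1
  have top := im_sub_im_eq_arg_sub_arg (F := fun s => L (s, 1)) (by fun_prop) (fun s => hL s 1)
    (fun s => by simpa [hδ1] using hγ s) 0 1
  have left := im_sub_im_eq_arg_neg_sub_arg_neg (F := fun t => L (0, t)) (by fun_prop)
    (fun t => hL 0 t) (fun t => by simpa [hγ0] using hδ t) 0 1
  simp only [hγ0, hγ1, hδ0, hδ1, neg_sub] at bottom right top left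
  rw [arg_pos hbc, arg_neg hab] at bottom
  rw [arg_pos hcd, arg_neg hbc] at right
  rw [arg_neg hcd, arg_neg (hab.trans (hbc.trans hcd))] at top
  rw [arg_pos (hab.trans (hbc.trans hcd)), arg_pos hab] at left
  linarith [Real.pi_pos]

end Winding

section Drawing

/-- The arc of a parabola in the closed upper half-plane that joins the points `a` and `b` of the
real line; a book embedding can draw its edges in this way. -/
noncomputable def parabolaArc (a b : ℝ) : C(unitInterval, ℂ) where
  toFun t := ⟨a + t * (b - a), (t * (b - a)) * ((1 - t) * (b - a))⟩
  continuous_toFun := by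
    simp only [Complex.mk_eq_add_mul_I]
    fun_prop

lemma parabolaArc_injective {a b : ℝ} (h : a ≠ b) : Function.Injective (parabolaArc a b) := by
  intro s t hst
  have hre := congrArg Complex.re hst
  simp only [parabolaArc, ContinuousMap.coe_mk, add_right_inj, mul_eq_mul_right_iff, sub_eq_zero,
    h.symm, or_false] at hre
  exact Subtype.ext hre

lemma parabolaArc_zero (a b : ℝ) : parabolaArc a b 0 = a := by
  apply Complex.ext <;> simp [parabolaArc]

lemma parabolaArc_one (a b : ℝ) : parabolaArc a b 1 = b := by
  apply Complex.ext <;> simp [parabolaArc]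

lemma parabolaArc_im (a b : ℝ) (t : unitInterval) : (parabolaArc a b t).im =
    ((parabolaArc a b t).re - a) * (b - (parabolaArc a b t).re) := by
  simp only [parabolaArc, ContinuousMap.coe_mk]
  ring

lemma parabolaArc_re_mem_Ioo {a b : ℝ} (h : a < b) {t : unitInterval} (ht : t ∈ Set.Ioo 0 1) :
    (parabolaArc a b t).re ∈ Set.Ioo a b := by
  have h0 : (0 : ℝ) < t := ht.1
  have h1 : (t : ℝ) < 1 := ht.2
  simp only [parabolaArc, ContinuousMap.coe_mk]
  constructor <;> nlinarith

lemma parabolaArc_im_pos {a b : ℝ} (h : a < b) {t : unitInterval} (ht : t ∈ Set.Ioo 0 1) :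
    0 < (parabolaArc a b t).im := by
  obtain ⟨h1, h2⟩ := parabolaArc_re_mem_Ioo h ht
  rw [parabolaArc_im]
  exact mul_pos (sub_pos.mpr h1) (sub_pos.mpr h2)

lemma parabolaArc_ne_of_not_interlacing {a b c d : ℝ} (hab : a < b) (hcd : c < d)
    (hne : (a, b) ≠ (c, d)) (h : ¬(a < c ∧ c < b ∧ b < d)) (h' : ¬(c < a ∧ a < d ∧ d < b))
    {s t : unitInterval} (hs : s ∈ Set.Ioo 0 1) (ht : t ∈ Set.Ioo 0 1) :
    parabolaArc a b s ≠ parabolaArc c d t := by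
  intro heq
  have hx := parabolaArc_re_mem_Ioo hab hs
  have hy := parabolaArc_re_mem_Ioo hcd ht
  have him := (parabolaArc_im a b s).symm.trans ((congrArg _ heq).trans (parabolaArc_im c d t))
  rw [heq] at hx him
  generalize (parabolaArc c d t).re = x at *
  obtain ⟨hax, hxb⟩ := hx
  obtain ⟨hcx, hxd⟩ := hy
  have nested : (a ≤ c ∧ d ≤ b) ∨ (c ≤ a ∧ b ≤ d) := by grind
  rcases nested with ⟨hac, hdb⟩ | ⟨hca, hbd⟩
  · obtain hac | hdb : a < c ∨ d < b := by grind
    all_goals nlinarith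
  · obtain hca | hbd : c < a ∨ b < d := by grind
    all_goals nlinarith

/-- The directed edges of a graph on linearly ordered vertices: `Ascent G u v` says that the edge
`{u, v}` belongs to `G` and that `u` is its left endpoint. -/
def Ascent {α : Type*} [LT α] (G : SimpleGraph α) (u v : α) : Prop := G.Adj u v ∧ u < v

lemma mk_inf_sup {α : Type*} [LinearOrder α] (e : Sym2 α) : s(e.inf, e.sup) = e :=
  Sym2.sortEquiv.symm_apply_apply e

lemma ascent_inf_sup {α : Type*} [LinearOrder α] {G : SimpleGraph α} (e : G.edgeSet) :
    Ascent G (e : Sym2 α).inf (e : Sym2 α).sup := by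
  have hadj : G.Adj (e : Sym2 α).inf (e : Sym2 α).sup := by
    rw [← SimpleGraph.mem_edgeSet, mk_inf_sup]
    exact e.2
  exact ⟨hadj, (Sym2.inf_le_sup _).lt_of_ne hadj.ne⟩

/-- Two edges `e` and `f` on linearly ordered vertices interlace, with `e` to the left, if the
ordered endpoints `e₁ < e₂` and `f₁ < f₂` satisfy `e₁ < f₁ < e₂ < f₂`. -/
def Interlace {α : Type*} [LinearOrder α] (e f : Sym2 α) : Prop :=
  e.inf < f.inf ∧ f.inf < e.sup ∧ e.sup < f.sup

lemma Interlace.notMem_of_mem {α : Type*} [LinearOrder α] {e f : Sym2 α} (h : Interlace e f) {x : α}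
    (hx : x ∈ e) : x ∉ f := by
  obtain ⟨h₁, h₂, h₃⟩ := h
  intro hx'
  induction e with | _ a b
  induction f with | _ c d
  simp only [Sym2.inf_mk, Sym2.sup_mk, Sym2.mem_iff] at *
  grind

lemma vertexPoint_injective {m : ℕ} : Function.Injective (vertexPoint : Fin m → ℂ) := by
  intro i j h
  simpa [vertexPoint, Fin.val_inj] using h

namespace BookDrawing

variable {m K : ℕ} {G : SimpleGraph (Fin m)} (D : BookDrawing G K)

lemma mem_Ioo_or_exists_arc_eq (e : G.edgeSet) (t : unitInterval) :
    t ∈ Set.Ioo 0 1 ∨ ∃ i ∈ (e : Sym2 (Fin m)), D.arc e t = vertexPoint i := by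
  have hends : ∀ z ∈ s(D.arc e 0, D.arc e 1), ∃ i ∈ (e : Sym2 (Fin m)), z = vertexPoint i :=
    fun z hz => by
      obtain ⟨i, hi, rfl⟩ := Sym2.mem_map.mp (D.arc_ends e ▸ hz)
      exact ⟨i, hi, rfl⟩
  rcases (unitInterval.nonneg' : 0 ≤ t).eq_or_lt with rfl | h0
  · exact Or.inr (hends _ (Sym2.mem_mk_left _ _))
  rcases (unitInterval.le_one' : t ≤ 1).eq_or_lt with rfl | h1
  · exact Or.inr (hends _ (Sym2.mem_mk_right _ _))
  exact Or.inl ⟨h0, h1⟩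

lemma arc_im_nonneg (e : G.edgeSet) (t : unitInterval) : 0 ≤ (D.arc e t).im := by
  rcases D.mem_Ioo_or_exists_arc_eq e t with ht | ⟨i, -, hi⟩
  · exact (D.arc_interior e t ht).le
  · simp [hi, vertexPoint]

lemma exists_mem_of_arc_eq {e f : G.edgeSet} (hne : e ≠ f) (hpage : D.page e = D.page f)
    {s t : unitInterval} (h : D.arc e s = D.arc f t) :
    ∃ i, i ∈ (e : Sym2 (Fin m)) ∧ i ∈ (f : Sym2 (Fin m)) := by
  have him := congrArg Complex.im h
  rcases D.mem_Ioo_or_exists_arc_eq e s with hs | ⟨i, hi, hei⟩ <;>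
    rcases D.mem_Ioo_or_exists_arc_eq f t with ht | ⟨j, hj, hfj⟩
  · exact absurd h (D.no_intersection e f hne hpage s hs t ht)
  · exact absurd (D.arc_interior e s hs) (by simp [him, hfj, vertexPoint])
  · exact absurd (D.arc_interior f t ht) (by simp [← him, hei, vertexPoint])
  · obtain rfl : i = j := vertexPoint_injective (by rw [← hei, h, hfj])
    exact ⟨i, hi, hj⟩

lemma exists_range_eq_range_arc (e : G.edgeSet) : ∃ γ : C(unitInterval, ℂ),
    γ 0 = vertexPoint (e : Sym2 (Fin m)).inf ∧ γ 1 = vertexPoint (e : Sym2 (Fin m)).sup ∧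
      Set.range γ = Set.range (D.arc e) := by
  have hends := D.arc_ends e
  rw [← mk_inf_sup (e : Sym2 (Fin m)), Sym2.map_mk, Sym2.eq_iff] at hends
  rcases hends with ⟨h0, h1⟩ | ⟨h0, h1⟩
  · exact ⟨D.arc e, h0, h1, rfl⟩
  · refine ⟨(D.arc e).comp ⟨unitInterval.symm, unitInterval.continuous_symm⟩, ?_, ?_, ?_⟩
    · simpa using h1
    · simpa using h0
    · exact unitInterval.symm_bijective.surjective.range_comp (D.arc e)

lemma not_interlace {e f : G.edgeSet} (hpage : D.page e = D.page f) :
    ¬Interlace (e : Sym2 (Fin m)) f := by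
  intro h
  obtain ⟨γ, hγ0, hγ1, hγ⟩ := D.exists_range_eq_range_arc e
  obtain ⟨δ, hδ0, hδ1, hδ⟩ := D.exists_range_eq_range_arc f
  have him : ∀ e, ∀ γ : C(unitInterval, ℂ), Set.range γ = Set.range (D.arc e) →
      ∀ t, 0 ≤ (γ t).im := fun e γ hγ t => by
    obtain ⟨s, hs⟩ := hγ ▸ Set.mem_range_self t
    exact hs ▸ D.arc_im_nonneg e s
  obtain ⟨s, t, hst⟩ := exists_eq_of_interlacing (a := ((e : Sym2 (Fin m)).inf : ℕ) + 1)
    (b := ((f : Sym2 (Fin m)).inf : ℕ) + 1) (c := ((e : Sym2 (Fin m)).sup : ℕ) + 1)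
    (d := ((f : Sym2 (Fin m)).sup : ℕ) + 1)
    (by simpa using h.1) (by simpa using h.2.1) (by simpa using h.2.2)
    (by simpa [vertexPoint] using hγ0) (by simpa [vertexPoint] using hγ1)
    (by simpa [vertexPoint] using hδ0) (by simpa [vertexPoint] using hδ1)
    (him e γ hγ) (him f δ hδ)
  obtain ⟨s', hs'⟩ := hγ ▸ Set.mem_range_self s
  obtain ⟨t', ht'⟩ := hδ ▸ Set.mem_range_self t
  have hne : e ≠ f := fun hef => by simp [hef, Interlace] at h
  obtain ⟨i, hie, hif⟩ := D.exists_mem_of_arc_eq hne hpage (hs'.trans (hst.trans ht'.symm))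
  exact h.notMem_of_mem hie hif

end BookDrawing

theorem exists_bookDrawing_page_eq_iff {m K : ℕ} {G : SimpleGraph (Fin m)}
    (page : G.edgeSet → Fin K) : (∃ D : BookDrawing G K, D.page = page) ↔
      ∀ e f, page e = page f → ¬Interlace (e : Sym2 (Fin m)) f := by
  refine ⟨?_, fun h => ?_⟩
  · rintro ⟨D, rfl⟩ e f
    exact D.not_interlace
  have hlt : ∀ e : G.edgeSet, (((e : Sym2 (Fin m)).inf : ℕ) : ℝ) + 1 <
      (((e : Sym2 (Fin m)).sup : ℕ) : ℝ) + 1 := fun e => by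
    simpa using (ascent_inf_sup e).2
  refine ⟨⟨page, fun e => parabolaArc (((e : Sym2 (Fin m)).inf : ℕ) + 1)
    (((e : Sym2 (Fin m)).sup : ℕ) + 1), fun e => parabolaArc_injective (hlt e).ne, fun e => ?_,
    fun e t => parabolaArc_im_pos (hlt e), fun e f hef hpage s hs t ht => ?_⟩, rfl⟩
  · conv_rhs => rw [← mk_inf_sup (e : Sym2 (Fin m)), Sym2.map_mk]
    simp [parabolaArc_zero, parabolaArc_one, vertexPoint]
  · refine parabolaArc_ne_of_not_interlacing (hlt e) (hlt f) (fun heq => hef (Subtype.ext ?_))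
      ?_ ?_ hs ht
    · simp only [Prod.mk.injEq, add_left_inj, Nat.cast_inj, Fin.val_inj] at heq
      exact Sym2.inf_eq_inf_and_sup_eq_sup.mp heq
    · simpa [Interlace] using h e f hpage
    · simpa [Interlace] using h f e hpage.symm

end Drawing

section Words

variable {n m : ℕ}

/-- The number of occurrences of the letter `a` among the first `x` letters of `w`. Here `a` is an
arbitrary natural number, so that the letter after the last one need not be treated separately. -/
def prefixCount (w : Fin m → Fin n) (a x : ℕ) : ℕ :=
  (Finset.univ.filter fun j : Fin m => (j : ℕ) < x ∧ (w j : ℕ) = a).card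

/-- The set of positions `j` with `x ≤ j < y` at which the word `w` has the letter `a`. -/
def letterPositions (w : Fin m → Fin n) (a x y : ℕ) : Finset (Fin m) :=
  Finset.univ.filter fun j => x ≤ (j : ℕ) ∧ (j : ℕ) < y ∧ (w j : ℕ) = a

lemma mem_letterPositions {w : Fin m → Fin n} {a x y : ℕ} {j : Fin m} :
    j ∈ letterPositions w a x y ↔ x ≤ (j : ℕ) ∧ (j : ℕ) < y ∧ (w j : ℕ) = a := by
  simp [letterPositions]

variable (w : Fin m → Fin n) (a : ℕ)

lemma prefixCount_zero : prefixCount w a 0 = 0 := by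
  simp [prefixCount]

lemma prefixCount_add_card_letterPositions {x y : ℕ} (h : x ≤ y) :
    prefixCount w a x + (letterPositions w a x y).card = prefixCount w a y := by
  rw [prefixCount, prefixCount, letterPositions, ← Finset.card_union_of_disjoint]
  · congr 1
    ext j
    simp only [Finset.mem_filter, Finset.mem_univ, true_and, Finset.mem_union]
    omega
  · rw [Finset.disjoint_filter]
    omega

lemma prefixCount_succ (j : Fin m) :
    prefixCount w a (j + 1) = prefixCount w a j + if (w j : ℕ) = a then 1 else 0 := by
  have : letterPositions w a j (j + 1) = if (w j : ℕ) = a then {j} else ∅ := by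
    ext i
    split_ifs <;> simp only [mem_letterPositions, Finset.mem_singleton, Finset.notMem_empty] <;>
      grind
  rw [← prefixCount_add_card_letterPositions w a (Nat.le_succ j), this]
  split_ifs <;> simp

lemma prefixCount_mono : Monotone (prefixCount w a) := fun _ _ h =>
  (Nat.le_add_right _ _).trans (prefixCount_add_card_letterPositions w a h).le

variable {a} in
lemma prefixCount_of_le (ha : n ≤ a) (x : ℕ) : prefixCount w a x = 0 := by
  rw [prefixCount, Finset.card_eq_zero, Finset.filter_eq_empty_iff]
  omega

lemma prefixCount_length (a : Fin n) :
    prefixCount w a m = (Finset.univ.filter fun j => w j = a).card := by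
  simp [prefixCount, Fin.ext_iff]

lemma prefixCount_min_length (x : ℕ) : prefixCount w a (min x m) = prefixCount w a x := by
  simp [prefixCount]

variable {w}

lemma isLatticeWord_iff_prefixCount :
    IsLatticeWord w ↔ ∀ a x, prefixCount w (a + 1) x ≤ prefixCount w a x := by
  have hcount : ∀ (i : Fin m) (a : Fin n),
      (Finset.univ.filter fun j => j ≤ i ∧ w j = a).card = prefixCount w a (i + 1) := fun i a => by
    simp only [prefixCount, Fin.ext_iff, Fin.le_def, Nat.lt_succ_iff]
  refine ⟨fun h a x => ?_, fun h i a b hab => ?_⟩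
  · rcases le_or_gt n (a + 1) with ha | ha
    · simp [prefixCount_of_le w ha]
    rw [← prefixCount_min_length, ← prefixCount_min_length w a]
    rcases hx : min x m with _ | y
    · simp [prefixCount_zero]
    · simpa only [hcount] using h ⟨y, by omega⟩ ⟨a, by omega⟩ ⟨a + 1, ha⟩ rfl
  · rw [hcount, hcount, ← hab]
    exact h a (i + 1)

variable (w)

/-- The surplus of the letter `a` over the letter `a + 1` among the first `x` letters of `w`. -/
def surplus (x : ℕ) : ℤ := prefixCount w a x - prefixCount w (a + 1) x

lemma surplus_succ (j : Fin m) :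
    surplus w a (j + 1) = surplus w a j + (if (w j : ℕ) = a then 1 else 0) -
      if (w j : ℕ) = a + 1 then 1 else 0 := by
  rw [surplus, surplus, prefixCount_succ, prefixCount_succ]
  push_cast
  ring

lemma surplus_add_card_letterPositions {x y : ℕ} (h : x ≤ y) :
    surplus w a y + (letterPositions w (a + 1) x y).card =
      surplus w a x + (letterPositions w a x y).card := by
  rw [surplus, surplus, ← prefixCount_add_card_letterPositions w a h,
    ← prefixCount_add_card_letterPositions w (a + 1) h]
  push_cast
  ring

/-- If every letter `a` is read as an opening parenthesis and every letter `a + 1` as a closing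
one, then the parentheses at `u` and `v` match each other, where `a` is the letter at `u`. -/
def Matches (u v : Fin m) : Prop :=
  u < v ∧ (w v : ℕ) = w u + 1 ∧ surplus w (w u) (v + 1) = surplus w (w u) u ∧
    ∀ l : ℕ, (u : ℕ) < l → l ≤ v → surplus w (w u) u < surplus w (w u) l

variable {w} {a}

lemma Matches.left_unique {u u' v : Fin m} (h : Matches w u v) (h' : Matches w u' v) : u = u' := by
  wlog hlt : u < u' generalizing u u'
  · rcases lt_trichotomy u u' with hl | hl | hl
    · exact this h h' hl
    · exact hl
    · exact (this h' h hl).symm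
  obtain ⟨-, hw, hv, hpos⟩ := h
  obtain ⟨hlt', hw', hv', -⟩ := h'
  rw [show (w u' : ℕ) = w u by omega] at hv'
  have := hpos u' hlt (le_of_lt hlt')
  omega

lemma Matches.right_unique {u v v' : Fin m} (h : Matches w u v) (h' : Matches w u v') : v = v' := by
  wlog hlt : v < v' generalizing v v'
  · rcases lt_trichotomy v v' with hl | hl | hl
    · exact this h h' hl
    · exact hl
    · exact (this h' h hl).symm
  have huv : (u : ℕ) < v := h.1
  exact absurd (h'.2.2.2 (v + 1) (by omega) hlt) h.2.2.1.not_gt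

lemma Matches.not_interlacing {u v u' v' : Fin m} (h : Matches w u v) (h' : Matches w u' v')
    (hw : w u = w u') : ¬(u < u' ∧ u' < v ∧ v < v') := by
  rintro ⟨huu', hu'v, hvv'⟩
  have hlt := h.2.2.2 u' huu' hu'v.le
  have hlt' := h'.2.2.2 (v + 1) (Nat.lt_succ_of_lt hu'v) hvv'
  rw [← hw, h.2.2.1] at hlt'
  exact hlt.not_gt hlt'

lemma exists_first_return {H : ℕ → ℤ} {u N : ℕ} (huN : u < N)
    (hstep : ∀ l < N, H l ≤ H (l + 1) + 1) (hu : H u < H (u + 1)) (hN : H N ≤ H u) :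
    ∃ v, u < v ∧ v < N ∧ H (v + 1) = H u ∧ ∀ l, u < l → l ≤ v → H u < H l := by
  classical
  have hex : ∃ l, u < l ∧ l ≤ N ∧ H l ≤ H u := ⟨N, huN, le_rfl, hN⟩
  obtain ⟨hux, hxN, hx⟩ := Nat.find_spec hex
  have hmin := fun l => Nat.find_min hex (m := l)
  obtain ⟨v, hv⟩ : ∃ v, Nat.find hex = v + 1 := Nat.exists_eq_succ_of_ne_zero (by omega)
  rw [hv] at hux hxN hx hmin
  have huv : u < v := (Nat.lt_succ_iff.mp hux).lt_of_ne fun h => by subst h; omega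
  have hpos : ∀ l, u < l → l ≤ v → H u < H l := fun l hul hlv => by
    have := hmin l (by omega)
    grind
  have := hpos v huv le_rfl
  have := hstep v hxN
  exact ⟨v, huv, hxN, by omega, hpos⟩

lemma exists_last_ascent {H : ℕ → ℤ} {v : ℕ} (hstep : ∀ l < v, H (l + 1) ≤ H l + 1)
    (hv : H (v + 1) < H v) (h0 : H 0 ≤ H (v + 1)) :
    ∃ u < v, H (v + 1) = H u ∧ ∀ l, u < l → l ≤ v → H u < H l := by
  classical
  let P : ℕ → Prop := fun l => H l ≤ H (v + 1)
  have hP : P (Nat.findGreatest P v) := Nat.findGreatest_spec (Nat.zero_le _) h0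
  have hmax : ∀ l, Nat.findGreatest P v < l → l ≤ v → H (v + 1) < H l := fun l hl hlv =>
    not_le.mp (Nat.findGreatest_is_greatest hl hlv)
  have hle := Nat.findGreatest_le (P := P) v
  generalize Nat.findGreatest P v = u at *
  have huv : u < v := hle.lt_of_ne fun h => by subst h; exact hv.not_ge hP
  have := hmax (u + 1) (by omega) huv
  have := hstep u huv
  have hu : H (v + 1) = H u := by grind
  exact ⟨u, huv, hu, fun l hul hlv => hu ▸ hmax l hul hlv⟩

lemma IsLatticeWord.surplus_nonneg (hw : IsLatticeWord w) (a x : ℕ) : 0 ≤ surplus w a x :=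
  sub_nonneg.mpr (by exact_mod_cast isLatticeWord_iff_prefixCount.mp hw a x)

lemma IsLatticeWord.exists_matches_right (hw : IsLatticeWord w) (u : Fin m)
    (hu : surplus w (w u) m = 0) : ∃ v, Matches w u v := by
  obtain ⟨v, huv, hvm, hv, hpos⟩ := exists_first_return (H := surplus w (w u)) u.2
    (fun l hl => by have := surplus_succ w (w u) ⟨l, hl⟩; grind)
    (by simp [surplus_succ]) (hu ▸ hw.surplus_nonneg _ _)
  refine ⟨⟨v, hvm⟩, huv, ?_, hv, hpos⟩
  have := surplus_succ w (w u) ⟨v, hvm⟩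
  have := hpos v huv le_rfl
  grind

lemma IsLatticeWord.exists_matches_left (hw : IsLatticeWord w) (v : Fin m)
    (hv : 0 < (w v : ℕ)) : ∃ u, Matches w u v := by
  obtain ⟨a, ha⟩ : ∃ a, (w v : ℕ) = a + 1 := Nat.exists_eq_succ_of_ne_zero hv.ne'
  obtain ⟨u, huv, hu, hpos⟩ := exists_last_ascent (H := surplus w a) (v := v)
    (fun l hl => by have := surplus_succ w a ⟨l, hl.trans v.2⟩; grind)
    (by simp [surplus_succ, ha]) (by simpa [surplus, prefixCount_zero] using hw.surplus_nonneg a _)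
  have hwu : (w ⟨u, huv.trans v.2⟩ : ℕ) = a := by
    have := surplus_succ w a ⟨u, huv.trans v.2⟩
    have := hpos (u + 1) (by omega) huv
    grind
  exact ⟨⟨u, huv.trans v.2⟩, huv, by omega, by rwa [hwu], by rwa [hwu]⟩

/-- `R` is a family of noncrossing perfect matchings in the word `w`: for each letter `a < n - 1`,
it matches the occurrences of `a` with later occurrences of the letter `a + 1`. -/
structure IsNoncrossingMatching (w : Fin m → Fin n) (R : Fin m → Fin m → Prop) : Prop where
  lt : ∀ {u v}, R u v → u < v
  letter : ∀ {u v}, R u v → (w v : ℕ) = w u + 1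
  left_unique : ∀ {u u' v}, R u v → R u' v → u = u'
  right_unique : ∀ {u v v'}, R u v → R u v' → v = v'
  exists_right : ∀ u, (w u : ℕ) + 1 < n → ∃ v, R u v
  exists_left : ∀ v, 0 < (w v : ℕ) → ∃ u, R u v
  not_interlacing : ∀ {u v u' v'}, R u v → R u' v' → w u = w u' → ¬(u < u' ∧ u' < v ∧ v < v')

lemma IsLatticeWord.isNoncrossingMatching_matches (hw : IsLatticeWord w)
    (hcount : ∀ a, a + 1 < n → surplus w a m = 0) : IsNoncrossingMatching w (Matches w) where
  lt h := h.1
  letter h := h.2.1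
  left_unique := Matches.left_unique
  right_unique := Matches.right_unique
  exists_right u hu := hw.exists_matches_right u (hcount _ hu)
  exists_left v hv := hw.exists_matches_left v hv
  not_interlacing := Matches.not_interlacing

namespace IsNoncrossingMatching

variable {R : Fin m → Fin m → Prop} (h : IsNoncrossingMatching w R)

include h

lemma isLatticeWord : IsLatticeWord w := by
  rw [isLatticeWord_iff_prefixCount]
  intro a x
  refine Finset.card_le_card_of_forall_subsingleton (fun v u => R u v) (fun v hv => ?_)
    fun u _ v hv v' hv' => h.right_unique hv.2 hv'.2
  rw [Finset.mem_filter] at hv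
  obtain ⟨u, huv⟩ := h.exists_left v (by omega)
  have hlt : (u : ℕ) < v := h.lt huv
  have hletter := h.letter huv
  exact ⟨u, by simp only [Finset.mem_filter, Finset.mem_univ, true_and]; omega, huv⟩

lemma surplus_lt {u v : Fin m} (huv : R u v) {l : ℕ} (hul : (u : ℕ) < l) (hlv : l ≤ v) :
    surplus w (w u) u < surplus w (w u) l := by
  have hu : u ∈ letterPositions w (w u) u l := by simp [mem_letterPositions, hul]
  have hcard : (letterPositions w (w u + 1) u l).card ≤
      ((letterPositions w (w u) u l).erase u).card := by
    refine Finset.card_le_card_of_forall_subsingleton (fun y x => R x y) (fun y hy => ?_)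
      fun x _ y hy y' hy' => h.right_unique hy.2 hy'.2
    rw [mem_letterPositions] at hy
    obtain ⟨x, hxy⟩ := h.exists_left y (by omega)
    have hlt : (x : ℕ) < y := h.lt hxy
    have hletter := h.letter hxy
    have hxu : x ≠ u := fun hxu => by
      have := h.right_unique (hxu ▸ hxy) huv
      grind
    have hux : u ≤ x := le_of_not_gt fun hxu =>
      h.not_interlacing hxy huv (by grind) ⟨hxu, by grind, by grind⟩
    exact ⟨x, by grind [mem_letterPositions], hxy⟩
  have hpos := Finset.card_pos.mpr ⟨u, hu⟩
  rw [Finset.card_erase_of_mem hu] at hcard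
  have := surplus_add_card_letterPositions w (w u) hul.le
  omega

lemma surplus_succ_le {u v : Fin m} (huv : R u v) :
    surplus w (w u) (v + 1) ≤ surplus w (w u) u := by
  have hlt : (u : ℕ) < v := h.lt huv
  have hletter := h.letter huv
  have hcard : (letterPositions w (w u) u (v + 1)).card ≤
      (letterPositions w (w u + 1) u (v + 1)).card := by
    refine Finset.card_le_card_of_forall_subsingleton R (fun x hx => ?_)
      fun y _ x hx x' hx' => h.left_unique hx.2 hx'.2
    rw [mem_letterPositions] at hx
    obtain ⟨y, hxy⟩ := h.exists_right x (by omega)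
    have hlt' : (x : ℕ) < y := h.lt hxy
    have hletter' := h.letter hxy
    have hyv : y ≤ v := by
      by_contra! hvy
      have hux : u ≠ x := fun hux => hvy.ne (h.right_unique huv (hux ▸ hxy))
      exact h.not_interlacing huv hxy (by grind) ⟨by grind, by grind, hvy⟩
    exact ⟨y, by grind [mem_letterPositions], hxy⟩
  have := surplus_add_card_letterPositions w (w u) (show (u : ℕ) ≤ v + 1 by omega)
  omega

lemma to_matches {u v : Fin m} (huv : R u v) : Matches w u v := by
  refine ⟨h.lt huv, h.letter huv, (h.surplus_succ_le huv).antisymm ?_, fun l => h.surplus_lt huv⟩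
  have := h.surplus_lt huv (h.lt huv) le_rfl
  have := surplus_succ w (w u) v
  grind [h.letter huv]

theorem eq_matches : R = Matches w := by
  ext u v
  refine ⟨h.to_matches, fun huv => ?_⟩
  obtain ⟨u', hu'⟩ := h.exists_left v (by have := huv.2.1; omega)
  rwa [huv.left_unique (h.to_matches hu')]

end IsNoncrossingMatching

end Words

section Counts

variable {n m : ℕ} {w : Fin m → Fin n} {R : Fin m → Fin m → Prop}

lemma sum_prefixCount_length (w : Fin m → Fin n) : ∑ a : Fin n, prefixCount w a m = m := by
  have := Finset.card_eq_sum_card_fiberwise (f := w) (s := Finset.univ) (t := Finset.univ)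
    (fun _ _ => Finset.mem_coe.mpr (Finset.mem_univ _))
  simpa [prefixCount_length] using this.symm

namespace IsNoncrossingMatching

variable (h : IsNoncrossingMatching w R)

include h

lemma surplus_length {a : ℕ} (ha : a + 1 < n) : surplus w a m = 0 := by
  refine le_antisymm (sub_nonpos.mpr (Nat.cast_le.mpr ?_)) (h.isLatticeWord.surplus_nonneg a m)
  refine Finset.card_le_card_of_forall_subsingleton R (fun u hu => ?_)
    fun v _ u hu u' hu' => h.left_unique hu.2 hu'.2
  rw [Finset.mem_filter] at hu
  obtain ⟨v, huv⟩ := h.exists_right u (by omega)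
  exact ⟨v, by simp [h.letter huv, hu.2.2], huv⟩

lemma prefixCount_length_eq (a : Fin n) : prefixCount w a m = prefixCount w 0 m := by
  obtain ⟨a, ha⟩ := a
  induction a with
  | zero => rfl
  | succ a ih =>
    have := h.surplus_length ha
    rw [← ih (by omega)]
    rw [surplus] at this
    simp only
    omega

lemma prefixCount_zero_length_mul : prefixCount w 0 m * n = m := by
  conv_rhs => rw [← sum_prefixCount_length w, Finset.sum_congr rfl
    fun a _ => h.prefixCount_length_eq a]
  simp [mul_comm]

end IsNoncrossingMatching

end Counts

section Waves

lemma fromRel_ascent {α : Type*} [LinearOrder α] (G : SimpleGraph α) :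
    SimpleGraph.fromRel (Ascent G) = G := by
  ext u v
  simp only [SimpleGraph.fromRel_adj, Ascent, G.adj_comm v u]
  exact ⟨by grind, fun h => ⟨h.ne, by grind [h.ne]⟩⟩

lemma ascent_fromRel {α : Type*} [Preorder α] {R : α → α → Prop} (hR : ∀ {u v}, R u v → u < v) :
    Ascent (SimpleGraph.fromRel R) = R := by
  ext u v
  simp only [Ascent, SimpleGraph.fromRel_adj]
  exact ⟨fun h => h.1.2.resolve_right fun hvu => (hR hvu).not_gt h.2,
    fun h => ⟨⟨(hR h).ne, Or.inl h⟩, hR h⟩⟩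

lemma ascent_or_ascent_of_adj {α : Type*} [LinearOrder α] {G : SimpleGraph α} {u v : α}
    (h : G.Adj u v) : Ascent G u v ∨ Ascent G v u :=
  h.ne.lt_or_gt.imp (⟨h, ·⟩) (⟨h.symm, ·⟩)

lemma exists_iso_connectedComponent {V W : Type*} {G : SimpleGraph V} {H : SimpleGraph W}
    (emb : H ↪g G) (hH : H.Preconnected) (hemb : ∀ a y, G.Adj (emb a) y → y ∈ Set.range emb)
    (a : W) :
    ∃ p : H ≃g (G.connectedComponentMk (emb a)).toSimpleGraph, ∀ b, (p b : V) = emb b := by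
  have hrange : Set.range emb = (G.connectedComponentMk (emb a)).supp := by
    ext x
    rw [SimpleGraph.ConnectedComponent.mem_supp_iff, SimpleGraph.ConnectedComponent.eq]
    constructor
    · rintro ⟨b, rfl⟩
      exact (hH b a).map emb.toHom
    · rw [SimpleGraph.reachable_comm, SimpleGraph.reachable_iff_reflTransGen]
      intro hx
      induction hx with
      | refl => exact Set.mem_range_self a
      | tail _ hxy ih =>
        obtain ⟨b, rfl⟩ := ih
        exact hemb b _ hxy
  have hiso : ∀ s, Set.range emb = s → ∃ p : H ≃g G.induce s, ∀ b, (p b : V) = emb b := by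
    rintro _ rfl
    exact ⟨emb.isoInduceRange, fun _ => rfl⟩
  exact hiso _ hrange

variable {n m : ℕ} {w : Fin m → Fin n} {R : Fin m → Fin m → Prop} {G : SimpleGraph (Fin m)}

lemma letter_eq_of_path {f : Fin n → Fin m} (hf : ∀ a b : Fin n, (a : ℕ) + 1 = b → R (f a) (f b))
    (hR : ∀ {u v}, R u v → (w v : ℕ) = w u + 1) (a : Fin n) : w (f a) = a := by
  have hmono : StrictMono (w ∘ f) := by
    rcases n with _ | n
    · exact fun a => a.elim0
    · exact Fin.strictMono_iff_lt_succ.mpr fun a => Fin.lt_def.mpr <| by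
        have := hR (hf a.castSucc a.succ (by simp))
        simp only [Function.comp_apply]
        omega
  have hrange : Set.range (w ∘ f) = Set.range (id : Fin n → Fin n) := by
    rw [(Finite.surjective_of_injective hmono.injective).range_eq, Set.range_id]
  exact congrFun ((StrictMono.range_inj hmono strictMono_id).mp hrange) a

lemma IsWave.letter_eq (hw : ∀ {u v}, Ascent G u v → (w v : ℕ) = w u + 1)
    {c : G.ConnectedComponent} {p : SimpleGraph.pathGraph n ≃g c.toSimpleGraph} (hp : IsWave c p)
    (a : Fin n) : w (p a) = a :=
  letter_eq_of_path (R := Ascent G) (f := fun a => (p a : Fin m)) (fun a b hab =>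
    ⟨p.map_adj_iff.mpr (SimpleGraph.pathGraph_adj.mpr (Or.inl hab)),
      hp (Fin.lt_def.mpr (by omega))⟩) hw a

namespace IsNoncrossingMatching

lemma exists_path_of_letter_eq_zero (h : IsNoncrossingMatching w R) {v : Fin m}
    (hv : (w v : ℕ) = 0) : ∃ f : Fin n → Fin m, f (w v) = v ∧
      ∀ a b : Fin n, (a : ℕ) + 1 = b → R (f a) (f b) := by
  have hnext : ∀ u, ∃ v, (w u : ℕ) + 1 < n → R u v := fun u => by
    by_cases hu : (w u : ℕ) + 1 < n
    · exact (h.exists_right u hu).imp fun v hv _ => hv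
    · exact ⟨u, fun h => absurd h hu⟩
  choose next hnext using hnext
  have hletter : ∀ a < n, (w (next^[a] v) : ℕ) = a := fun a => by
    induction a with
    | zero => exact fun _ => hv
    | succ a ih =>
      intro ha
      have ih := ih (by omega)
      rw [Function.iterate_succ_apply', h.letter (hnext _ (by omega)), ih]
  refine ⟨fun a => next^[a] v, by simp [hv], fun a b hab => ?_⟩
  simp only [← hab, Function.iterate_succ_apply']
  exact hnext _ (by rw [hletter a a.2, hab]; exact b.2)

lemma exists_path (h : IsNoncrossingMatching w R) (v : Fin m) : ∃ f : Fin n → Fin m,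
    f (w v) = v ∧ ∀ a b : Fin n, (a : ℕ) + 1 = b → R (f a) (f b) := by
  induction hd : (w v : ℕ) generalizing v with
  | zero => exact h.exists_path_of_letter_eq_zero hd
  | succ d ih =>
    obtain ⟨u, huv⟩ := h.exists_left v (by omega)
    have hletter := h.letter huv
    obtain ⟨f, hfu, hf⟩ := ih u (by omega)
    have hnext := hf (w u) (w v) hletter.symm
    exact ⟨f, h.right_unique (hfu ▸ hnext) huv, hf⟩

lemma word_unique {w' : Fin m → Fin n} (h : IsNoncrossingMatching w R)
    (h' : IsNoncrossingMatching w' R) : w = w' := by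
  ext v
  obtain ⟨f, hfv, hf⟩ := h.exists_path v
  rw [← letter_eq_of_path hf h'.letter (w v), hfv]

lemma exists_isWave (h : IsNoncrossingMatching w (Ascent G)) (c : G.ConnectedComponent) :
    ∃ p : SimpleGraph.pathGraph n ≃g c.toSimpleGraph, IsWave c p := by
  induction c using SimpleGraph.ConnectedComponent.ind with | h v =>
  obtain ⟨f, hfv, hf⟩ := h.exists_path v
  have hwf := letter_eq_of_path hf h.letter
  have hmono : StrictMono f := by
    rcases n with _ | n
    · exact fun a => a.elim0
    · exact Fin.strictMono_iff_lt_succ.mpr fun a => h.lt (hf _ _ (by simp))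
  let emb : SimpleGraph.pathGraph n ↪g G :=
    { toFun := f
      inj' := hmono.injective
      map_rel_iff' := fun {a b} => by
        simp only [Function.Embedding.coeFn_mk, SimpleGraph.pathGraph_adj]
        constructor
        · intro hab
          have := (ascent_or_ascent_of_adj hab).imp h.letter h.letter
          simp only [hwf] at this
          omega
        · exact Or.rec (fun hab => (hf a b hab).1) fun hba => (hf b a hba).1.symm }
  have hemb : ∀ a y, G.Adj (emb a) y → y ∈ Set.range emb := fun a y hay => by
    have hwa : w (emb a) = a := hwf a
    refine ⟨w y, ?_⟩
    rcases ascent_or_ascent_of_adj hay with hay | hya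
    · exact h.right_unique (hf a (w y) (by rw [h.letter hay, hwa])) hay
    · exact h.left_unique (hf (w y) a (by rw [← h.letter hya, hwa])) hya
  rw [← hfv]
  obtain ⟨p, hp⟩ :=
    exists_iso_connectedComponent emb (SimpleGraph.pathGraph_preconnected n) hemb (w v)
  refine ⟨p, ?_⟩
  simp only [IsWave, hp]
  exact hmono

lemma isWaveGraph (h : IsNoncrossingMatching w (Ascent G)) : IsWaveGraph n G := by
  choose wave hwave using h.exists_isWave
  have hletter : ∀ e : G.edgeSet,
      (w (e : Sym2 (Fin m)).sup : ℕ) = w (e : Sym2 (Fin m)).inf + 1 :=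
    fun e => h.letter (ascent_inf_sup e)
  obtain ⟨D, hD⟩ := (exists_bookDrawing_page_eq_iff (K := n - 1)
    fun e : G.edgeSet => ⟨w (e : Sym2 (Fin m)).inf, by have := hletter e; omega⟩).mpr
      fun e f hef => h.not_interlacing (ascent_inf_sup e) (ascent_inf_sup f)
        (Fin.ext (Fin.mk.inj hef))
  refine ⟨wave, hwave, D, fun c a b e hab he => ?_⟩
  have hlt : (wave c a : Fin m) < wave c b := hwave c (Fin.lt_def.mpr (by omega))
  rw [hD]
  simp [he, hlt.le, (hwave c).letter_eq h.letter]

end IsNoncrossingMatching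

variable (wave : ∀ c : G.ConnectedComponent, SimpleGraph.pathGraph n ≃g c.toSimpleGraph)

/-- The position of each vertex of an `n`-wave graph in the path which is its component. -/
def wavePosition (v : Fin m) : Fin n := (wave (G.connectedComponentMk v)).symm ⟨v, rfl⟩

lemma wavePosition_wave (c : G.ConnectedComponent) (a : Fin n) :
    wavePosition wave (wave c a) = a := by
  have h : ∀ x : c, wavePosition wave x = (wave c).symm x := by
    rintro ⟨v, rfl⟩
    rfl
  rw [h, RelIso.symm_apply_apply]

lemma exists_wave_eq (v : Fin m) : ∃ c a, (wave c a : Fin m) = v :=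
  ⟨_, wavePosition wave v, by rw [wavePosition, RelIso.apply_symm_apply]⟩

lemma ascent_wave_iff (hwave : ∀ c, IsWave c (wave c)) {c d : G.ConnectedComponent} {a b : Fin n} :
    Ascent G (wave c a) (wave d b) ↔ c = d ∧ (a : ℕ) + 1 = b := by
  have hadj : ∀ c, G.Adj (wave c a) (wave c b) ↔ (a : ℕ) + 1 = b ∨ (b : ℕ) + 1 = a := fun c => by
    rw [← SimpleGraph.pathGraph_adj, ← (wave c).map_adj_iff]
    rfl
  constructor
  · rintro ⟨h, hlt⟩
    obtain rfl : c = d := by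
      rw [← (wave c a).2, ← (wave d b).2]
      exact SimpleGraph.ConnectedComponent.sound h.reachable
    have hab : a < b := (hwave c).lt_iff_lt.mp hlt
    exact ⟨rfl, by rcases (hadj c).mp h with h | h <;> omega⟩
  · rintro ⟨rfl, h⟩
    exact ⟨(hadj c).mpr (Or.inl h), hwave c (Fin.lt_def.mpr (by omega))⟩

lemma page_eq_wavePosition (hwave : ∀ c, IsWave c (wave c)) {K : ℕ} {D : BookDrawing G K}
    (hD : ∀ (c : G.ConnectedComponent) (a b : Fin n) (e : G.edgeSet), (a : ℕ) + 1 = b →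
      (e : Sym2 (Fin m)) = s((wave c a : Fin m), (wave c b : Fin m)) → (D.page e : ℕ) = a)
    {u v : Fin m} (h : Ascent G u v) : (D.page ⟨s(u, v), h.1⟩ : ℕ) = wavePosition wave u := by
  obtain ⟨c, a, rfl⟩ := exists_wave_eq wave u
  obtain ⟨d, b, rfl⟩ := exists_wave_eq wave v
  obtain ⟨rfl, hab⟩ := (ascent_wave_iff wave hwave).mp h
  rw [wavePosition_wave]
  exact hD c a b _ hab rfl

lemma isNoncrossingMatching_wavePosition (hwave : ∀ c, IsWave c (wave c)) {K : ℕ}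
    {D : BookDrawing G K}
    (hD : ∀ (c : G.ConnectedComponent) (a b : Fin n) (e : G.edgeSet), (a : ℕ) + 1 = b →
      (e : Sym2 (Fin m)) = s((wave c a : Fin m), (wave c b : Fin m)) → (D.page e : ℕ) = a) :
    IsNoncrossingMatching (wavePosition wave) (Ascent G) := by
  have hsurj := exists_wave_eq wave
  have hiff := @ascent_wave_iff _ _ _ wave hwave
  have hpos := wavePosition_wave wave
  refine ⟨And.right, fun {u v} h => ?_, fun {u u' v} h h' => ?_, fun {u v v'} h h' => ?_,
    fun u hu => ?_, fun v hv => ?_, fun {u v u' v'} h h' hw => ?_⟩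
  · obtain ⟨c, a, rfl⟩ := hsurj u
    obtain ⟨d, b, rfl⟩ := hsurj v
    rw [hpos, hpos, (hiff.mp h).2]
  · obtain ⟨c, a, rfl⟩ := hsurj u
    obtain ⟨c', a', rfl⟩ := hsurj u'
    obtain ⟨d, b, rfl⟩ := hsurj v
    obtain ⟨rfl, hab⟩ := hiff.mp h
    obtain ⟨rfl, hab'⟩ := hiff.mp h'
    rw [Fin.ext (Nat.succ_injective (hab.trans hab'.symm))]
  · obtain ⟨c, a, rfl⟩ := hsurj u
    obtain ⟨d, b, rfl⟩ := hsurj v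
    obtain ⟨d', b', rfl⟩ := hsurj v'
    obtain ⟨rfl, hab⟩ := hiff.mp h
    obtain ⟨rfl, hab'⟩ := hiff.mp h'
    rw [Fin.ext (hab.symm.trans hab')]
  · obtain ⟨c, a, rfl⟩ := hsurj u
    rw [hpos] at hu
    exact ⟨wave c ⟨a + 1, hu⟩, hiff.mpr ⟨rfl, rfl⟩⟩
  · obtain ⟨c, a, rfl⟩ := hsurj v
    rw [hpos] at hv
    exact ⟨wave c ⟨a - 1, by omega⟩, hiff.mpr ⟨rfl, Nat.sub_add_cancel hv⟩⟩
  · have := D.not_interlace (e := ⟨s(u, v), h.1⟩) (f := ⟨s(u', v'), h'.1⟩)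
      (Fin.ext (by
        rw [page_eq_wavePosition wave hwave hD h, page_eq_wavePosition wave hwave hD h', hw]))
    simpa [Interlace, h.2.le, h'.2.le] using this

theorem isWaveGraph_iff_exists_isNoncrossingMatching :
    IsWaveGraph n G ↔ ∃ w : Fin m → Fin n, IsNoncrossingMatching w (Ascent G) :=
  ⟨fun ⟨wave, hwave, _, hD⟩ => ⟨_, isNoncrossingMatching_wavePosition wave hwave hD⟩,
    fun ⟨_, h⟩ => h.isWaveGraph⟩

lemma IsWaveGraph.exists_eq_mul (hG : IsWaveGraph n G) : ∃ k, m = k * n := by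
  obtain ⟨w, h⟩ := isWaveGraph_iff_exists_isNoncrossingMatching.mp hG
  exact ⟨_, h.prefixCount_zero_length_mul.symm⟩

theorem exists_waveGraph_equiv {k : ℕ} (hm : m = k * n) :
    ∃ Φ : WaveGraph n m ≃ BalancedLatticeWord n k m,
      ∀ (G : WaveGraph n m) (c : G.1.ConnectedComponent)
        (p : SimpleGraph.pathGraph n ≃g c.toSimpleGraph), IsWave c p →
          ∀ a : Fin n, (Φ G).1 (p a) = a := by
  have hword : ∀ G : WaveGraph n m, ∃ W : BalancedLatticeWord n k m,
      IsNoncrossingMatching W.1 (Ascent G.1) := fun G => by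
    obtain ⟨w, h⟩ := isWaveGraph_iff_exists_isNoncrossingMatching.mp G.2
    refine ⟨⟨w, h.isLatticeWord, fun a => Nat.eq_of_mul_eq_mul_right a.pos ?_⟩, h⟩
    rw [← prefixCount_length, h.prefixCount_length_eq, h.prefixCount_zero_length_mul, hm]
  choose Φ hΦ using hword
  refine ⟨Equiv.ofBijective Φ ⟨fun G G' h => Subtype.ext ?_, fun W => ?_⟩,
    fun G c p hp => hp.letter_eq (hΦ G).letter⟩
  · rw [← fromRel_ascent G.1, ← fromRel_ascent G'.1, (hΦ G).eq_matches, (hΦ G').eq_matches, h]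
  · have hmatch : IsNoncrossingMatching W.1 (Matches W.1) :=
      W.2.1.isNoncrossingMatching_matches fun a ha => by
        have := prefixCount_length W.1 ⟨a, by omega⟩
        have := prefixCount_length W.1 ⟨a + 1, ha⟩
        simp_all [surplus, W.2.2]
    let G := SimpleGraph.fromRel (Matches W.1)
    have hG : IsNoncrossingMatching W.1 (Ascent G) := by rwa [ascent_fromRel hmatch.lt]
    exact ⟨⟨G, hG.isWaveGraph⟩, Subtype.ext ((hΦ ⟨G, hG.isWaveGraph⟩).word_unique hG)⟩

end Waves

section Tableaux

namespace StandardTableau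

variable {μ : YoungDiagram} (T : StandardTableau μ)

lemma exists_cell {x : ℕ} (hx : x ∈ Set.Icc 1 μ.card) : ∃ r c, (r, c) ∈ μ ∧ T.1 r c = x := by
  obtain ⟨⟨r, c⟩, hrc, h⟩ := T.2.surjOn hx
  exact ⟨r, c, hrc, h⟩

lemma cell_unique {r c r' c' : ℕ} (hrc : (r, c) ∈ μ) (hrc' : (r', c') ∈ μ)
    (h : T.1 r c = T.1 r' c') : r = r' ∧ c = c' :=
  Prod.mk_inj.mp (T.2.injOn hrc hrc' h)

end StandardTableau

variable {n m : ℕ} {μ : YoungDiagram} {T : StandardTableau μ} {w : Fin m → Fin n}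

/-- The letter at the position `i` of the word `w` is the number of the column of the tableau `T`
which contains the entry `i`. (Letters, columns and positions are numbered from `0`, entries of
tableaux from `1`.) -/
def IsColumnWord (T : StandardTableau μ) (w : Fin m → Fin n) : Prop :=
  ∀ (i : Fin m) (r c : ℕ), (r, c) ∈ μ → T.1 r c = i + 1 → (w i : ℕ) = c

lemma exists_isColumnWord (T : StandardTableau μ) (hm : μ.card = m) (hn : μ.rowLen 0 ≤ n) :
    ∃ w : Fin m → Fin n, IsColumnWord T w := by
  have hcell : ∀ i : Fin m, ∃ c : Fin n, ∃ r, (r, (c : ℕ)) ∈ μ ∧ T.1 r c = i + 1 := fun i => by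
    obtain ⟨r, c, hrc, h⟩ := T.exists_cell (x := i + 1) (by rw [Set.mem_Icc]; omega)
    have hc : c < μ.rowLen 0 :=
      (YoungDiagram.mem_iff_lt_rowLen.mp hrc).trans_le (μ.rowLen_anti 0 r r.zero_le)
    exact ⟨⟨c, hc.trans_le hn⟩, r, hrc, h⟩
  choose w r hr hw using hcell
  exact ⟨w, fun i r' c' hrc' h => (T.cell_unique (hr i) hrc' ((hw i).trans h.symm)).2⟩

lemma lt_card_filter_range_iff {P : ℕ → Prop} [DecidablePred P] {N r : ℕ}
    (hP : ∀ a b, a ≤ b → b < N → P b → P a) (hr : r < N) :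
    r < ((Finset.range N).filter P).card ↔ P r := by
  constructor
  · contrapose!
    intro hr'
    have hsub : (Finset.range N).filter P ⊆ Finset.range r := fun b hb => by
      rw [Finset.mem_filter, Finset.mem_range] at hb
      exact Finset.mem_range.mpr (not_le.mp fun hle => hr' (hP r b hle hb.1 hb.2))
    simpa using Finset.card_le_card hsub
  · intro hr'
    have hsub : Finset.range (r + 1) ⊆ (Finset.range N).filter P := fun a ha => by
      have ha := Finset.mem_range_succ_iff.mp ha
      simpa [ha.trans_lt hr] using hP a r ha hr hr'
    simpa using Finset.card_le_card hsub

namespace IsColumnWord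

variable (h : IsColumnWord T w) (hm : μ.card = m)

include h hm

lemma prefixCount_eq (c x : ℕ) :
    prefixCount w c x = ((Finset.range (μ.colLen c)).filter fun r => T.1 r c ≤ x).card := by
  subst hm
  apply le_antisymm
  · refine Finset.card_le_card_of_forall_subsingleton (fun (i : Fin μ.card) r => T.1 r c = i + 1)
      (fun i hi => ?_) fun r _ i ⟨_, hi⟩ i' ⟨_, hi'⟩ => Fin.ext (by omega)
    simp only [Finset.mem_filter, Finset.mem_univ, true_and] at hi
    obtain ⟨r, c', hrc, hT⟩ := T.exists_cell (x := i + 1) (by rw [Set.mem_Icc]; omega)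
    obtain rfl : c = c' := hi.2.symm.trans (h i r c' hrc hT)
    refine ⟨r, ?_, hT⟩
    simp only [Finset.mem_filter, Finset.mem_range, ← YoungDiagram.mem_iff_lt_colLen]
    exact ⟨hrc, by omega⟩
  · refine Finset.card_le_card_of_forall_subsingleton (fun r (i : Fin μ.card) => T.1 r c = i + 1)
      (fun r hr => ?_) fun i _ r ⟨hr, hri⟩ r' ⟨hr', hri'⟩ => ?_
    · simp only [Finset.mem_filter, Finset.mem_range, ← YoungDiagram.mem_iff_lt_colLen] at hr
      obtain ⟨h1, h2⟩ := T.2.mapsTo hr.1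
      dsimp only at h1 h2
      refine ⟨⟨T.1 r c - 1, by omega⟩, ?_, by simp only; omega⟩
      simp only [Finset.mem_filter, Finset.mem_univ, true_and]
      exact ⟨by omega, h _ r c hr.1 (by simp only; omega)⟩
    · simp only [Finset.mem_filter, Finset.mem_range, ← YoungDiagram.mem_iff_lt_colLen] at hr hr'
      exact (T.cell_unique hr.1 hr'.1 (hri.trans hri'.symm)).1

lemma lt_prefixCount_iff {r c : ℕ} (hrc : (r, c) ∈ μ) (x : ℕ) :
    r < prefixCount w c x ↔ T.1 r c ≤ x := by
  rw [h.prefixCount_eq hm]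
  exact lt_card_filter_range_iff (fun a b hab hb hbx =>
    (T.1.col_weak hab (YoungDiagram.mem_iff_lt_colLen.mpr hb)).trans hbx)
    (YoungDiagram.mem_iff_lt_colLen.mp hrc)

lemma isLatticeWord : IsLatticeWord w := by
  rw [isLatticeWord_iff_prefixCount]
  intro c x
  rw [h.prefixCount_eq hm, h.prefixCount_eq hm]
  refine Finset.card_le_card fun r hr => ?_
  simp only [Finset.mem_filter, Finset.mem_range, ← YoungDiagram.mem_iff_lt_colLen] at hr ⊢
  exact ⟨μ.up_left_mem le_rfl (Nat.le_succ c) hr.1,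
    (T.1.row_weak (Nat.lt_succ_self c) hr.1).trans hr.2⟩

lemma prefixCount_length_eq (c : ℕ) : prefixCount w c m = μ.colLen c := by
  rw [h.prefixCount_eq hm, Finset.filter_true_of_mem, Finset.card_range]
  intro r hr
  rw [Finset.mem_range, ← YoungDiagram.mem_iff_lt_colLen] at hr
  exact (T.2.mapsTo hr).2.trans hm.le

end IsColumnWord

/-- The position of the `r`-th letter `c` of a word, where occurrences are numbered from `0` but
positions from `1`, as are the entries of a tableau; it is `0` if there is no such letter. -/
noncomputable def occurrence (w : Fin m → Fin n) (c r : ℕ) : ℕ := sInf {x | r < prefixCount w c x}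

lemma occurrence_of_le {c r : ℕ} (hr : prefixCount w c m ≤ r) : occurrence w c r = 0 := by
  refine Nat.sInf_eq_zero.mpr (Or.inr (Set.eq_empty_of_forall_notMem fun x hx => ?_))
  have hx : r < prefixCount w c x := hx
  rw [← prefixCount_min_length] at hx
  exact (hx.trans_le (prefixCount_mono w c (min_le_right x m))).not_ge hr

lemma occurrence_le_iff {c r : ℕ} (hr : r < prefixCount w c m) {x : ℕ} :
    occurrence w c r ≤ x ↔ r < prefixCount w c x :=
  ⟨fun h => (Nat.sInf_mem (s := {x | r < prefixCount w c x}) ⟨m, hr⟩).trans_le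
    (prefixCount_mono w c h), fun h => Nat.sInf_le h⟩

lemma occurrence_mem_Icc {c r : ℕ} (hr : r < prefixCount w c m) :
    occurrence w c r ∈ Set.Icc 1 m := by
  refine ⟨Nat.succ_le_of_lt (not_le.mp ?_), (occurrence_le_iff hr).mpr hr⟩
  rw [occurrence_le_iff hr, prefixCount_zero]
  exact Nat.not_lt_zero r

lemma occurrence_eq_succ_iff {c r : ℕ} (hr : r < prefixCount w c m) {i : Fin m} :
    occurrence w c r = i + 1 ↔ (w i : ℕ) = c ∧ prefixCount w c i = r := by
  have h1 := occurrence_le_iff hr (x := i)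
  have h2 := occurrence_le_iff hr (x := i + 1)
  rw [prefixCount_succ] at h2
  split_ifs at h2 <;> omega

lemma IsLatticeWord.prefixCount_antitone (hw : IsLatticeWord w) (x : ℕ) :
    Antitone fun c => prefixCount w c x :=
  antitone_nat_of_succ_le fun c => isLatticeWord_iff_prefixCount.mp hw c x

lemma mem_iff_lt_prefixCount (hμ : ∀ c, prefixCount w c m = μ.colLen c) {r c : ℕ} :
    (r, c) ∈ μ ↔ r < prefixCount w c m := by
  rw [hμ, YoungDiagram.mem_iff_lt_colLen]

/-- The tableau of shape `μ` whose `c`-th column lists the positions of the letter `c` in a lattice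
word which contains each letter `c` as often as there are cells in the `c`-th column of `μ`. -/
noncomputable def occurrenceTableau (hw : IsLatticeWord w)
    (hμ : ∀ c, prefixCount w c m = μ.colLen c) : SemistandardYoungTableau μ where
  entry r c := occurrence w c r
  row_weak' {r c c'} hcc h := by
    rw [mem_iff_lt_prefixCount hμ] at h
    have hr := hw.prefixCount_antitone m hcc.le
    rw [occurrence_le_iff (h.trans_le hr)]
    exact ((occurrence_le_iff h).mp le_rfl).trans_le (hw.prefixCount_antitone _ hcc.le)
  col_strict' {r r' c} hrr h := by
    rw [mem_iff_lt_prefixCount hμ] at h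
    have hpos := occurrence_mem_Icc h
    rw [Set.mem_Icc] at hpos
    obtain ⟨i, hi⟩ : ∃ i : Fin m, occurrence w c r' = i + 1 :=
      ⟨⟨occurrence w c r' - 1, by omega⟩, by simp only; omega⟩
    rw [hi, Nat.lt_succ_iff, occurrence_le_iff (hrr.trans h)]
    exact hrr.trans_eq ((occurrence_eq_succ_iff h).mp hi).2.symm
  zeros' h := occurrence_of_le (not_lt.mp (mt (mem_iff_lt_prefixCount hμ).mpr h))

lemma bijOn_occurrenceTableau (hw : IsLatticeWord w) (hμ : ∀ c, prefixCount w c m = μ.colLen c)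
    (hm : μ.card = m) :
    Set.BijOn (fun c : ℕ × ℕ => occurrenceTableau hw hμ c.1 c.2) μ.cells (Set.Icc 1 μ.card) := by
  have hmem : ∀ {x : ℕ × ℕ}, x ∈ (μ.cells : Set (ℕ × ℕ)) ↔ x.1 < prefixCount w x.2 m :=
    mem_iff_lt_prefixCount hμ
  have hsucc : ∀ {x}, x ∈ Set.Icc 1 m → ∃ i : Fin m, x = i + 1 := fun {x} hx =>
    ⟨⟨x - 1, by have := hx.1; have := hx.2; omega⟩, (Nat.sub_add_cancel hx.1).symm⟩
  rw [hm]
  refine ⟨fun x hx => occurrence_mem_Icc (hmem.mp hx), fun x hx y hy hxy => ?_, fun p hp => ?_⟩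
  · obtain ⟨i, hi⟩ := hsucc (occurrence_mem_Icc (hmem.mp hx))
    obtain ⟨hc, hr⟩ := (occurrence_eq_succ_iff (hmem.mp hx)).mp hi
    obtain ⟨hc', hr'⟩ := (occurrence_eq_succ_iff (hmem.mp hy)).mp (hxy.symm.trans hi)
    have hcol : x.2 = y.2 := hc.symm.trans hc'
    exact Prod.ext (by rw [← hr, ← hr', hcol]) hcol
  · obtain ⟨i, rfl⟩ := hsucc hp
    have hlt : prefixCount w (w i) i < prefixCount w (w i) m := by
      have := prefixCount_mono w (w i) (Nat.succ_le_of_lt i.2)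
      rw [Nat.succ_eq_add_one, prefixCount_succ, if_pos rfl] at this
      exact this
    exact ⟨(_, _), hmem.mpr hlt, (occurrence_eq_succ_iff hlt).mpr ⟨rfl, rfl⟩⟩

lemma isColumnWord_occurrenceTableau (hw : IsLatticeWord w)
    (hμ : ∀ c, prefixCount w c m = μ.colLen c) (hm : μ.card = m) :
    IsColumnWord ⟨occurrenceTableau hw hμ, bijOn_occurrenceTableau hw hμ hm⟩ w :=
  fun _ _ _ hrc h => ((occurrence_eq_succ_iff ((mem_iff_lt_prefixCount hμ).mp hrc)).mp h).1

lemma prefixCount_length_eq_colLen (hn : μ.rowLen 0 ≤ n)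
    (hw : ∀ a : Fin n, (Finset.univ.filter fun j => w j = a).card = μ.colLen a) (c : ℕ) :
    prefixCount w c m = μ.colLen c := by
  rcases lt_or_ge c n with hc | hc
  · exact (prefixCount_length w ⟨c, hc⟩).trans (hw ⟨c, hc⟩)
  · rw [prefixCount_of_le w hc, eq_comm]
    refine Nat.eq_zero_of_not_pos fun h => ?_
    rw [← YoungDiagram.mem_iff_lt_colLen, YoungDiagram.mem_iff_lt_rowLen] at h
    omega

theorem exists_standardTableau_equiv_latticeWord (hm : μ.card = m) (hn : μ.rowLen 0 ≤ n) :
    ∃ Ψ : StandardTableau μ ≃ {w : Fin m → Fin n // IsLatticeWord w ∧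
        ∀ a : Fin n, (Finset.univ.filter fun j => w j = a).card = μ.colLen a},
      ∀ (T : StandardTableau μ) (i : Fin m) (r c : ℕ),
        (r, c) ∈ μ → T.1 r c = i + 1 → ((Ψ T).1 i : ℕ) = c := by
  have hword : ∀ T : StandardTableau μ, ∃ W : {w : Fin m → Fin n // IsLatticeWord w ∧
      ∀ a : Fin n, (Finset.univ.filter fun j => w j = a).card = μ.colLen a},
      IsColumnWord T W.1 := fun T => by
    obtain ⟨w, h⟩ := exists_isColumnWord T hm hn
    refine ⟨⟨w, h.isLatticeWord hm, fun a => ?_⟩, h⟩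
    rw [← prefixCount_length, h.prefixCount_length_eq hm]
  choose Ψ hΨ using hword
  refine ⟨Equiv.ofBijective Ψ ⟨fun T T' h => Subtype.ext ?_, fun W => ?_⟩, hΨ⟩
  · ext r c
    by_cases hrc : (r, c) ∈ μ
    · refine eq_of_forall_ge_iff fun x => ?_
      rw [← (hΨ T).lt_prefixCount_iff hm hrc, ← (hΨ T').lt_prefixCount_iff hm hrc, h]
    · rw [T.1.zeros hrc, T'.1.zeros hrc]
  · have hμ := prefixCount_length_eq_colLen hn W.2.2
    let T : StandardTableau μ := ⟨_, bijOn_occurrenceTableau W.2.1 hμ hm⟩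
    refine ⟨T, Subtype.ext (funext fun i => Fin.ext ?_)⟩
    obtain ⟨r, c, hrc, h⟩ := T.exists_cell (x := i + 1) (by rw [Set.mem_Icc]; omega)
    rw [hΨ T i r c hrc h, isColumnWord_occurrenceTableau W.2.1 hμ hm i r c hrc h]

lemma card_rectDiagram (n k : ℕ) : (rectDiagram n k).card = k * n := by
  simp [YoungDiagram.card, rectDiagram]

lemma mem_rectDiagram {k r c : ℕ} : (r, c) ∈ rectDiagram n k ↔ r < k ∧ c < n := by
  simp [← YoungDiagram.mem_cells, rectDiagram]

lemma colLen_rectDiagram {k c : ℕ} (hc : c < n) : (rectDiagram n k).colLen c = k :=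
  eq_of_forall_lt_iff fun r => by
    rw [← YoungDiagram.mem_iff_lt_colLen, mem_rectDiagram, and_iff_left hc]

lemma rowLen_rectDiagram_le (n k r : ℕ) : (rectDiagram n k).rowLen r ≤ n :=
  not_lt.mp fun h => (mem_rectDiagram.mp (YoungDiagram.mem_iff_lt_rowLen.mpr h)).2.false

theorem exists_standardTableau_equiv {k : ℕ} (hm : m = k * n) :
    ∃ Ψ : StandardTableau (rectDiagram n k) ≃ BalancedLatticeWord n k m,
      ∀ (T : StandardTableau (rectDiagram n k)) (i : Fin m) (r c : ℕ),
        (r, c) ∈ rectDiagram n k → T.1 r c = i + 1 → ((Ψ T).1 i : ℕ) = c := by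
  obtain ⟨Ψ, hΨ⟩ := exists_standardTableau_equiv_latticeWord
    ((card_rectDiagram n k).trans hm.symm) (rowLen_rectDiagram_le n k 0)
  exact ⟨Ψ.trans (Equiv.subtypeEquivRight fun w => by simp [colLen_rectDiagram]), hΨ⟩

end Tableaux

section Determinants

lemma sum_det_updateRow_mul {ι R : Type*} [Fintype ι] [DecidableEq ι] [CommRing R]
    (A : Matrix ι ι R) (d : ι → R) :
    ∑ i, (A.updateRow i fun j => d j * A i j).det = (∑ j, d j) * A.det := by
  have hdet : ∀ i, (A.updateRow i fun j => d j * A i j).det =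
      ∑ σ : Equiv.Perm ι, (Equiv.Perm.sign σ : R) * (d (σ i) * ∏ x, A x (σ x)) := fun i => by
    rw [← Matrix.det_transpose, Matrix.det_apply']
    refine Finset.sum_congr rfl fun σ _ => congrArg _ ?_
    rw [← Finset.mul_prod_erase _ _ (Finset.mem_univ i),
      ← Finset.mul_prod_erase _ (fun x => A x (σ x)) (Finset.mem_univ i), ← mul_assoc,
      Matrix.transpose_apply, Matrix.updateRow_self]
    refine congrArg _ (Finset.prod_congr rfl fun x hx => ?_)
    rw [Matrix.transpose_apply, Matrix.updateRow_ne (Finset.ne_of_mem_erase hx)]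
  simp_rw [hdet]
  rw [Finset.sum_comm, ← Matrix.det_transpose, Matrix.det_apply', Finset.mul_sum]
  refine Finset.sum_congr rfl fun σ _ => ?_
  rw [← Finset.mul_sum, ← Finset.sum_mul, Equiv.sum_comp σ d]
  simp only [Matrix.transpose_apply]
  ring

lemma sum_det_updateRow_add_mul {ι R : Type*} [Fintype ι] [DecidableEq ι] [CommRing R]
    (A : Matrix ι ι R) (l d : ι → R) :
    ∑ i, (A.updateRow i fun j => (l i + d j) * A i j).det =
      (∑ i, l i + ∑ j, d j) * A.det := by
  have hdet : ∀ i, (A.updateRow i fun j => (l i + d j) * A i j).det =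
      l i * A.det + (A.updateRow i fun j => d j * A i j).det := fun i => by
    have hrow : (fun j => (l i + d j) * A i j) = l i • A i + fun j => d j * A i j := by
      ext j
      simp only [Pi.add_apply, Pi.smul_apply, smul_eq_mul, add_mul]
    rw [hrow, Matrix.det_updateRow_add, Matrix.det_updateRow_smul, Matrix.updateRow_eq_self]
  simp_rw [hdet]
  rw [Finset.sum_add_distrib, sum_det_updateRow_mul, ← Finset.sum_mul, add_mul]

/-- The reciprocal `1 / x!`, extended by `0` to negative integers `x`, so that
`x * (1 / x!) = 1 / (x - 1)!` holds for all integers. -/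
def invFactorial (x : ℤ) : ℚ := if x < 0 then 0 else (x.toNat ! : ℚ)⁻¹

lemma invFactorial_of_neg {x : ℤ} (hx : x < 0) : invFactorial x = 0 := if_pos hx

lemma invFactorial_natCast (k : ℕ) : invFactorial k = (k ! : ℚ)⁻¹ := by
  simp [invFactorial]

lemma mul_invFactorial (x : ℤ) : x * invFactorial x = invFactorial (x - 1) := by
  obtain hx | rfl | ⟨k, rfl⟩ : x < 0 ∨ x = 0 ∨ ∃ k : ℕ, x = (k + 1 : ℕ) := by
    rcases lt_trichotomy x 0 with hx | hx | hx
    · exact Or.inl hx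
    · exact Or.inr (Or.inl hx)
    · exact Or.inr (Or.inr ⟨(x - 1).toNat, by omega⟩)
  · rw [invFactorial_of_neg hx, invFactorial_of_neg (by omega), mul_zero]
  · rw [Int.cast_zero, zero_mul, invFactorial_of_neg (by omega)]
  · rw [invFactorial_natCast, show ((k + 1 : ℕ) : ℤ) - 1 = k by omega, invFactorial_natCast,
      Nat.factorial_succ]
    push_cast
    field_simp

lemma invFactorial_sub (l j : ℕ) : invFactorial (l - j) = (l ! : ℚ)⁻¹ * l.descFactorial j := by
  rcases le_or_gt j l with h | h
  · rw [← Nat.cast_sub h, invFactorial_natCast, ← Nat.factorial_mul_descFactorial h]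
    have := Nat.pos_of_ne_zero (mt Nat.descFactorial_eq_zero_iff_lt.mp h.not_gt)
    push_cast
    field_simp
  · rw [invFactorial_of_neg (by omega), Nat.descFactorial_of_lt h, Nat.cast_zero, mul_zero]

variable {n : ℕ} {μ : Fin n → ℤ}

/-- The matrix with the entries `1 / (μ i - i + j)!`, whose determinant multiplied by `|μ|!` is, for
a partition `μ`, the number of standard Young tableaux with rows of lengths `μ i`. -/
def jacobiTrudiMatrix (μ : Fin n → ℤ) : Matrix (Fin n) (Fin n) ℚ :=
  Matrix.of fun i j => invFactorial (μ i - i + j)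

lemma jacobiTrudiMatrix_sub_single (μ : Fin n → ℤ) (a : Fin n) :
    jacobiTrudiMatrix (μ - Pi.single a 1) = (jacobiTrudiMatrix μ).updateRow a fun j =>
      (((μ a - a : ℤ) : ℚ) + (j : ℕ)) * jacobiTrudiMatrix μ a j := by
  ext i j
  rcases eq_or_ne i a with rfl | hia
  · have := mul_invFactorial (μ i - i + j)
    simp only [jacobiTrudiMatrix, Matrix.of_apply, Matrix.updateRow_self, Pi.sub_apply,
      Pi.single_eq_same]
    push_cast at this ⊢
    rw [this]
    ring_nf
  · simp [jacobiTrudiMatrix, hia]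

lemma sum_det_jacobiTrudiMatrix_sub_single (μ : Fin n → ℤ) :
    ∑ a, (jacobiTrudiMatrix (μ - Pi.single a 1)).det =
      ((∑ a, μ a : ℤ) : ℚ) * (jacobiTrudiMatrix μ).det := by
  simp_rw [jacobiTrudiMatrix_sub_single]
  rw [sum_det_updateRow_add_mul (jacobiTrudiMatrix μ) (fun a => ((μ a - a : ℤ) : ℚ))
    fun j => ((j : ℕ) : ℚ)]
  push_cast
  rw [Finset.sum_sub_distrib, sub_add_cancel]

lemma det_jacobiTrudiMatrix_eq_zero_of_eq_add_one {a b : Fin n} (hab : (a : ℕ) + 1 = b)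
    (hμ : μ b = μ a + 1) : (jacobiTrudiMatrix μ).det = 0 := by
  refine Matrix.det_zero_of_row_eq (i := a) (j := b) (Fin.ne_of_val_ne (by omega)) ?_
  ext j
  simp only [jacobiTrudiMatrix, Matrix.of_apply]
  congr 1
  omega

lemma det_jacobiTrudiMatrix_eq_zero_of_eq_neg_one {a : Fin n} (ha : (a : ℕ) + 1 = n)
    (hμ : μ a = -1) : (jacobiTrudiMatrix μ).det = 0 :=
  Matrix.det_eq_zero_of_row_eq_zero a fun j => invFactorial_of_neg (by omega)

lemma det_jacobiTrudiMatrix_zero : (jacobiTrudiMatrix (0 : Fin n → ℤ)).det = 1 := by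
  rw [Matrix.det_of_isUpperTriangular]
  · exact Finset.prod_eq_one fun i _ => by simp [jacobiTrudiMatrix, invFactorial]
  · intro i j hij
    have hij : (j : ℕ) < i := hij
    exact invFactorial_of_neg (by simp only [Pi.zero_apply]; omega)

-- After a reversal of the rows and columns and a scaling of the rows, this is a Vandermonde
-- determinant.
lemma det_jacobiTrudiMatrix_const (n k : ℕ) :
    (jacobiTrudiMatrix fun _ : Fin n => (k : ℤ)).det =
      (∏ i ∈ Finset.Icc 1 (n - 1), (i ! : ℚ)) / ∏ i ∈ Finset.range n, ((k + i)! : ℚ) := by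
  rcases n with _ | n
  · simp
  have hrev : (jacobiTrudiMatrix fun _ : Fin (n + 1) => (k : ℤ)).det =
      (Matrix.of fun i j : Fin (n + 1) => ((k + i)! : ℚ)⁻¹ *
        (descPochhammer ℚ j).eval ((i : ℚ) + k)).det := by
    rw [← Matrix.det_submatrix_equiv_self Fin.revPerm]
    congr 1
    ext i j
    have hentry : (k : ℤ) - (i.rev : ℕ) + (j.rev : ℕ) = (k + i : ℕ) - (j : ℕ) := by
      simp only [Fin.val_rev]
      omega
    simp only [jacobiTrudiMatrix, Matrix.submatrix_apply, Matrix.of_apply, Fin.revPerm_apply]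
    rw [hentry, invFactorial_sub, ← descPochhammer_eval_eq_descFactorial, Nat.cast_add,
      add_comm (k : ℚ)]
  have hscale := Matrix.det_mul_column (fun i : Fin (n + 1) => ((k + i)! : ℚ)⁻¹)
    (Matrix.of fun i j : Fin (n + 1) => (descPochhammer ℚ j).eval ((i : ℚ) + k))
  simp only [Matrix.of_apply] at hscale
  rw [hrev, hscale, ← Matrix.det_eval_matrixOfPolynomials_eq_det_vandermonde _ _
    (fun i => descPochhammer_natDegree ℚ i) (fun i => monic_descPochhammer ℚ i),
    Matrix.det_vandermonde_add, Matrix.det_vandermonde_id_eq_superFactorial,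
    ← Nat.prod_Icc_factorial, Finset.prod_inv_distrib, div_eq_inv_mul, Nat.add_sub_cancel,
    Fin.prod_univ_eq_prod_range (fun i => ((k + i)! : ℚ))]
  push_cast
  rfl

end Determinants

section Counting

variable {n m : ℕ} {μ : Fin n → ℤ}

open Classical in
/-- The set of lattice words of length `m` in which each letter `a` occurs `μ a` times. The numbers
`μ a` are integers, so that they can be decreased without case distinctions. -/
noncomputable def latticeWords (m : ℕ) (μ : Fin n → ℤ) : Finset (Fin m → Fin n) :=
  Finset.univ.filter fun w => IsLatticeWord w ∧ ∀ a : Fin n, (prefixCount w a m : ℤ) = μ a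

lemma mem_latticeWords {w : Fin m → Fin n} :
    w ∈ latticeWords m μ ↔ IsLatticeWord w ∧ ∀ a : Fin n, (prefixCount w a m : ℤ) = μ a := by
  simp [latticeWords]

lemma nonneg_of_mem_latticeWords {w : Fin m → Fin n} (hw : w ∈ latticeWords m μ) (a : Fin n) :
    0 ≤ μ a := by
  rw [← (mem_latticeWords.mp hw).2 a]
  exact Nat.cast_nonneg _

lemma antitone_of_mem_latticeWords {w : Fin m → Fin n} (hw : w ∈ latticeWords m μ) :
    Antitone μ := fun a b hab => by
  obtain ⟨hw, hμ⟩ := mem_latticeWords.mp hw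
  rw [← hμ, ← hμ]
  exact_mod_cast hw.prefixCount_antitone m hab

lemma prefixCount_snoc (w : Fin m → Fin n) (a : Fin n) (c x : ℕ) :
    prefixCount (Fin.snoc w a : Fin (m + 1) → Fin n) c x =
      prefixCount w c x + if m < x ∧ (a : ℕ) = c then 1 else 0 := by
  simp only [prefixCount, Finset.card_filter, Fin.sum_univ_castSucc, Fin.snoc_castSucc,
    Fin.snoc_last, Fin.val_castSucc, Fin.val_last]

lemma isLatticeWord_snoc_iff {w : Fin m → Fin n} {a : Fin n} :
    IsLatticeWord (Fin.snoc w a : Fin (m + 1) → Fin n) ↔ IsLatticeWord w ∧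
      Antitone fun c => prefixCount (Fin.snoc w a : Fin (m + 1) → Fin n) c (m + 1) := by
  refine ⟨fun h => ⟨?_, h.prefixCount_antitone _⟩, fun ⟨h, hlast⟩ => ?_⟩
  · rw [isLatticeWord_iff_prefixCount] at h ⊢
    intro c x
    simpa [prefixCount_snoc, prefixCount_min_length] using h c (min x m)
  · rw [isLatticeWord_iff_prefixCount] at h ⊢
    intro c x
    rw [← prefixCount_min_length, ← prefixCount_min_length _ c]
    rcases le_or_gt x m with hx | hx
    · simpa [prefixCount_snoc, hx.not_gt, hx.trans (Nat.le_succ m)] using h c x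
    · rw [min_eq_right hx]
      exact hlast (Nat.le_succ c)

lemma snoc_mem_latticeWords (hμ : Antitone μ) {w : Fin m → Fin n} {a : Fin n} :
    (Fin.snoc w a : Fin (m + 1) → Fin n) ∈ latticeWords (m + 1) μ ↔
      w ∈ latticeWords m (μ - Pi.single a 1) := by
  have hcontent : (∀ b : Fin n,
      (prefixCount (Fin.snoc w a : Fin (m + 1) → Fin n) b (m + 1) : ℤ) = μ b) ↔
        ∀ b : Fin n, (prefixCount w b m : ℤ) = (μ - Pi.single a 1 : Fin n → ℤ) b := by
    refine forall_congr' fun b => ?_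
    rw [prefixCount_snoc, ← prefixCount_min_length w b, min_eq_right (Nat.le_succ m),
      Pi.sub_apply, Pi.single_apply]
    grind
  rw [mem_latticeWords, mem_latticeWords, hcontent, isLatticeWord_snoc_iff, and_assoc]
  refine and_congr_right fun _ => and_iff_right_of_imp fun hw => ?_
  refine antitone_nat_of_succ_le fun c => ?_
  rcases le_or_gt n (c + 1) with hc | hc
  · simp [prefixCount_of_le _ hc]
  · have h := hcontent.mpr hw
    have := hμ (show (⟨c, by omega⟩ : Fin n) ≤ ⟨c + 1, hc⟩ from Nat.le_succ c)
    rw [← h, ← h] at this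
    exact_mod_cast this

lemma card_latticeWords_succ (hμ : Antitone μ) : (latticeWords (m + 1) μ).card =
    ∑ a, (latticeWords m (μ - Pi.single a 1)).card := by
  rw [← Finset.card_sigma]
  refine Finset.card_bij' (fun w _ => ⟨w (Fin.last m), Fin.init w⟩)
    (fun p _ => Fin.snoc p.2 p.1) (fun w hw => ?_) (fun p hp => ?_)
    (fun w _ => Fin.snoc_init_self w) fun p _ => ?_
  · rw [Finset.mem_sigma, ← snoc_mem_latticeWords hμ, Fin.snoc_init_self]
    exact ⟨Finset.mem_univ _, hw⟩
  · exact (snoc_mem_latticeWords hμ).mpr (Finset.mem_sigma.mp hp).2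
  · rw [Fin.snoc_last, Fin.init_snoc]

lemma sub_single_cases (hμ : Antitone μ) (h0 : ∀ a, 0 ≤ μ a) {ν : Fin n → ℤ} {a : Fin n}
    (hν : ν = μ - Pi.single a 1) :
    (Antitone ν ∧ ∀ b, 0 ≤ ν b) ∨ (∃ b : Fin n, (a : ℕ) + 1 = b ∧ ν b = ν a + 1) ∨
      ((a : ℕ) + 1 = n ∧ ν a = -1) := by
  have hν : ∀ b, ν b = μ b - if b = a then 1 else 0 := fun b => by
    rw [hν, Pi.sub_apply, Pi.single_apply]
  by_cases ha : (a : ℕ) + 1 < n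
  · obtain ⟨b, hb⟩ : ∃ b : Fin n, (b : ℕ) = a + 1 := ⟨⟨a + 1, ha⟩, rfl⟩
    have hba : μ b ≤ μ a := hμ (Fin.le_def.mpr (by omega))
    rcases hba.eq_or_lt with h | h
    · exact Or.inr (Or.inl ⟨b, hb.symm, by grind⟩)
    · refine Or.inl ⟨fun i j hij => ?_, fun i => by grind⟩
      have := hμ hij
      have hbj : a < j → μ j ≤ μ b := fun haj => hμ (Fin.le_def.mpr (by omega))
      grind
  · have hlast : ∀ j, a ≤ j → j = a := fun j haj => Fin.ext (by omega)
    rcases (h0 a).eq_or_lt with h | h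
    · exact Or.inr (Or.inr ⟨by omega, by grind⟩)
    · refine Or.inl ⟨fun i j hij => ?_, fun i => by grind⟩
      have := hμ hij
      grind

theorem card_latticeWords (hμ : Antitone μ) (h0 : ∀ a, 0 ≤ μ a) (hm : ∑ a, μ a = m) :
    ((latticeWords m μ).card : ℚ) = m ! * (jacobiTrudiMatrix μ).det := by
  induction m generalizing μ with
  | zero =>
    obtain rfl : μ = 0 := funext fun a =>
      (Finset.sum_eq_zero_iff_of_nonneg fun a _ => h0 a).mp hm a (Finset.mem_univ a)
    have huniv : latticeWords 0 (0 : Fin n → ℤ) = Finset.univ :=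
      Finset.eq_univ_of_forall fun w =>
        mem_latticeWords.mpr ⟨fun i => i.elim0, fun a => by simp [prefixCount_zero]⟩
    rw [huniv, det_jacobiTrudiMatrix_zero]
    simp
  | succ m ih =>
    have hterm : ∀ a, ((latticeWords m (μ - Pi.single a 1)).card : ℚ) =
        m ! * (jacobiTrudiMatrix (μ - Pi.single a 1)).det := fun a => by
      rcases sub_single_cases hμ h0 rfl with ⟨hμ', h0'⟩ | ⟨b, hab, hb⟩ | ⟨ha, hneg⟩
      · exact ih hμ' h0' (by simp [Finset.sum_sub_distrib, hm])
      · rw [det_jacobiTrudiMatrix_eq_zero_of_eq_add_one hab hb, mul_zero, Nat.cast_eq_zero,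
          Finset.card_eq_zero, Finset.eq_empty_iff_forall_notMem]
        intro w hw
        have := antitone_of_mem_latticeWords hw (show a ≤ b from Fin.le_def.mpr (by omega))
        omega
      · rw [det_jacobiTrudiMatrix_eq_zero_of_eq_neg_one ha hneg, mul_zero, Nat.cast_eq_zero,
          Finset.card_eq_zero, Finset.eq_empty_iff_forall_notMem]
        intro w hw
        have := nonneg_of_mem_latticeWords hw a
        omega
    rw [card_latticeWords_succ hμ, Nat.cast_sum, Finset.sum_congr rfl fun a _ => hterm a,
      ← Finset.mul_sum, sum_det_jacobiTrudiMatrix_sub_single, hm, Nat.factorial_succ]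
    push_cast
    ring

theorem card_balancedLatticeWord {k : ℕ} (hm : m = k * n) :
    (Nat.card (BalancedLatticeWord n k m) : ℚ) =
      ((m ! : ℚ) * ∏ i ∈ Finset.Icc 1 (n - 1), (i ! : ℚ)) /
        ∏ i ∈ Finset.range n, ((k + i)! : ℚ) := by
  have hcard : Nat.card (BalancedLatticeWord n k m) =
      (latticeWords m fun _ : Fin n => (k : ℤ)).card := by
    rw [← Nat.card_eq_finsetCard]
    refine Nat.card_congr (Equiv.subtypeEquivRight fun w => ?_)
    simp only [mem_latticeWords, prefixCount_length, Nat.cast_inj]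
  rw [hcard, card_latticeWords antitone_const (fun _ => Nat.cast_nonneg k)
    (by simp [hm, mul_comm]), det_jacobiTrudiMatrix_const, mul_div_assoc]

end Counting

theorem lemma4 (n m : ℕ) (hn : 1 ≤ n) :
    (Nat.card (WaveGraph n m) ≠ 0 ↔ ∃ k : ℕ, m = k * n) ∧
    ∀ k : ℕ, m = k * n →
      (Nat.card (WaveGraph n m) : ℚ) =
        ((m ! : ℚ) * ∏ i ∈ Finset.Icc 1 (n - 1), (i ! : ℚ)) /
          ∏ i ∈ Finset.range n, ((k + i)! : ℚ) ∧
      -- the `N`-th vertex of each path of the graph becomes a position of the letter `N`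
      (∃ Φ : WaveGraph n m ≃ BalancedLatticeWord n k m,
        ∀ (G : WaveGraph n m) (c : G.1.ConnectedComponent)
          (p : SimpleGraph.pathGraph n ≃g c.toSimpleGraph), IsWave c p →
            ∀ a : Fin n, (Φ G).1 (p a) = a) ∧
      -- the `i`-th letter is the column of the entry `i` in the tableau
      (∃ Ψ : StandardTableau (rectDiagram n k) ≃ BalancedLatticeWord n k m,
        ∀ (T : StandardTableau (rectDiagram n k)) (i : Fin m) (r c : ℕ),
          (r, c) ∈ rectDiagram n k → T.1 r c = i + 1 → ((Ψ T).1 i : ℕ) = c) := by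
  have hcard : ∀ k : ℕ, m = k * n → (Nat.card (WaveGraph n m) : ℚ) =
      ((m ! : ℚ) * ∏ i ∈ Finset.Icc 1 (n - 1), (i ! : ℚ)) /
        ∏ i ∈ Finset.range n, ((k + i)! : ℚ) := fun k hm => by
    obtain ⟨Φ, -⟩ := exists_waveGraph_equiv hm
    rw [Nat.card_congr Φ, card_balancedLatticeWord hm]
  refine ⟨⟨fun h => ?_, ?_⟩, fun k hm =>
    ⟨hcard k hm, exists_waveGraph_equiv hm, exists_standardTableau_equiv hm⟩⟩
  · obtain ⟨G⟩ := (Nat.card_ne_zero.mp h).1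
    exact G.2.exists_eq_mul
  · rintro ⟨k, hm⟩ h
    have := hcard k hm
    rw [h, Nat.cast_zero] at this
    have hpos : (0 : ℚ) < ((m ! : ℚ) * ∏ i ∈ Finset.Icc 1 (n - 1), (i ! : ℚ)) /
        ∏ i ∈ Finset.range n, ((k + i)! : ℚ) := by positivity
    exact hpos.ne this
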